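/- Conventions. We use the language of first-order arithmetic with constant $0$, unary $S$, binary $+,\times$ and relation symbols $=,\leq$. Pre-formulas are in negation normal form: they are built from the literals $s=t$, $\neg\,s=t$, $s\leq t$, $\neg\,s\leq t$ by $\land$, $\lor$ and quantifiers $\forall v_{2i}$, $\exists v_{2i}$ over variables of even index. A formula (term) is a pre-formula (pre-term) in which only variables of odd index are free; a sentence is a formula without free variables; a theory is a set of sentences. The negation $\neg\varphi$ of a formula is defined by de Morgan duality, $\varphi\to\psi$ is $\neg\varphi\lor\psi$, $\varphi\leftrightarrow\psi$ is $(\varphi\to\psi)\land(\psi\to\varphi)$, and $\bot$ is $0=0\land\neg\,0=0$. For a finite set $\Gamma$ of formulas, $\vdash\Gamma$ denotes derivability of $\Gamma$ (read as the disjunction of its elements) in the one-sided (Tait-style) sequent calculus of classical predicate logic with cut. For a theory $\mathsf T$, $\mathsf T\vdash\varphi$ means that $\vdash\neg\theta_1,\ldots,\neg\theta_n,\varphi$ holds for some $\theta_1,\ldots,\theta_n\in\mathsf T$, and $\mathsf T$ is consistent if $\mathsf T\nvdash\bot$. Robinson arithmetic $\mathsf Q$ consists of the equality axioms (reflexivity,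 symmetry, transitivity, and compatibility of $=$ with $0,S,+,\times,=,\leq$) and the universal closures of $$Sx=Sy\to x=y,\quad x\neq 0\leftrightarrow\exists y\,x=Sy,\quad x\leq y\leftrightarrow\exists z\,z+x=y,$$ $$x+0=x,\quad x+Sy=S(x+y),\quad x\times 0=0,\quad x\times Sy=(x\times y)+x.$$ Let $\pi(m,n)=n+\frac{(m+n)(m+n+1)}2$, $\langle\rangle=0$ and $\langle a_0,\ldots,a_n\rangle=\pi(\langle a_0,\ldots,a_{n-1}\rangle,a_n)+1$. Gödel numbers are given by $$\ulcorner v_i\urcorner=\langle 0,0,i\rangle,\quad\ulcorner 0\urcorner=\langle 0,1\rangle,\quad\ulcorner St\urcorner=\langle 0,2,\ulcorner t\urcorner\rangle,\quad\ulcorner s+t\urcorner=\langle 0,3,\ulcorner s\urcorner,\ulcorner t\urcorner\rangle,\quad\ulcorner s\times t\urcorner=\langle 0,4,\ulcorner s\urcorner,\ulcorner t\urcorner\rangle,$$ by $\langle 1,k,\ulcorner s\urcorner,\ulcorner t\urcorner\rangle$ with $k=0,1,2,3$ for $s=t$, $\neg\,s=t$, $s\leq t$, $\neg\,s\leq t$,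 by $\langle 1,4,\ulcorner\varphi\urcorner,\ulcorner\psi\urcorner\rangle$ and $\langle 1,5,\ulcorner\varphi\urcorner,\ulcorner\psi\urcorner\rangle$ for $\varphi\land\psi$ and $\varphi\lor\psi$, and by $\langle 1,6,2i,\ulcorner\varphi\urcorner\rangle$ and $\langle 1,7,2i,\ulcorner\varphi\urcorner\rangle$ for $\forall v_{2i}\,\varphi$ and $\exists v_{2i}\,\varphi$. The numeral $\overline n$ is the term $S\cdots S0$ with $n$ occurrences of $S$. Theorem (Löb's theorem and Gödel's second incompleteness theorem). Let $\mathsf T\supseteq\mathsf Q$ be a theory and let $\operatorname{Pr}_{\mathsf T}(y)$ be a formula of first-order arithmetic with no free variable other than $y$, such that the following Hilbert–Bernays conditions hold for all sentences $\varphi$ and $\psi$: (D1) if $\mathsf T\vdash\varphi$, then $\mathsf T\vdash\operatorname{Pr}_{\mathsf T}(\overline{\ulcorner\varphi\urcorner})$; (D2) $\mathsf T\vdash\operatorname{Pr}_{\mathsf T}(\overline{\ulcorner\varphi\urcorner})\to\operatorname{Pr}_{\mathsf T}\big(\overline{\ulcorner\operatorname{Pr}_{\mathsf T}(\overline{\ulcorner\varphi\urcorner})\urcorner}\big)$;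 (D3) $\mathsf T\vdash\operatorname{Pr}_{\mathsf T}(\overline{\ulcorner\varphi\to\psi\urcorner})\land\operatorname{Pr}_{\mathsf T}(\overline{\ulcorner\varphi\urcorner})\to\operatorname{Pr}_{\mathsf T}(\overline{\ulcorner\psi\urcorner})$. Then: (a) for every sentence $\varphi$, if $\mathsf T\vdash\operatorname{Pr}_{\mathsf T}(\overline{\ulcorner\varphi\urcorner})\to\varphi$, then $\mathsf T\vdash\varphi$; (b) if $\mathsf T$ is consistent, then $\mathsf T\nvdash\neg\operatorname{Pr}_{\mathsf T}(\overline{\ulcorner 0=S0\urcorner})$. -/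

import Mathlib

namespace FOArith

/-- Pre-terms over the signature `0, S, +, ×` of first-order arithmetic;
`var i` is the variable `v_i`. -/
inductive PreTerm : Type
  | var (i : ℕ)
  | zero
  | succ (t : PreTerm)
  | add (s t : PreTerm)
  | mul (s t : PreTerm)
  deriving DecidableEq

/-- Pre-formulas (in negation normal form) with the binary relation symbols `=` and `≤`.
The constructors `neq` and `nle` are the negated atoms `¬ s = t` and `¬ s ≤ t`.
Only variables with even index can be bound: `all i φ` and `ex i φ` are `∀ v_{2i} φ` and
`∃ v_{2i} φ`. -/
inductive PreFormula : Type
  | eq (s t : PreTerm)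
  | neq (s t : PreTerm)
  | le (s t : PreTerm)
  | nle (s t : PreTerm)
  | and (φ ψ : PreFormula)
  | or (φ ψ : PreFormula)
  | all (i : ℕ) (φ : PreFormula)
  | ex (i : ℕ) (φ : PreFormula)
  deriving DecidableEq

namespace PreTerm

/-- Indices of the (free) variables of a pre-term. -/
def FV : PreTerm → Finset ℕ
  | var i => {i}
  | zero => ∅
  | succ t => t.FV
  | add s t => s.FV ∪ t.FV
  | mul s t => s.FV ∪ t.FV

/-- A term is a pre-term in which no variable with even index is free. -/
def IsTerm (t : PreTerm) : Prop := ∀ i ∈ t.FV, Odd i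

/-- `s.subst i t` is `s[v_i/t]`. -/
def subst (s : PreTerm) (i : ℕ) (t : PreTerm) : PreTerm :=
  match s with
  | var j => if i = j then t else var j
  | zero => zero
  | succ s => succ (s.subst i t)
  | add s₁ s₂ => add (s₁.subst i t) (s₂.subst i t)
  | mul s₁ s₂ => mul (s₁.subst i t) (s₂.subst i t)

end PreTerm

/-- The numerals: `0, S0, SS0, …`. -/
def numeral : ℕ → PreTerm
  | 0 => PreTerm.zero
  | n + 1 => PreTerm.succ (numeral n)

namespace PreFormula

/-- Indices of the free variables of a pre-formula. -/
def FV : PreFormula → Finset ℕ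
  | eq s t => s.FV ∪ t.FV
  | neq s t => s.FV ∪ t.FV
  | le s t => s.FV ∪ t.FV
  | nle s t => s.FV ∪ t.FV
  | and φ ψ => φ.FV ∪ ψ.FV
  | or φ ψ => φ.FV ∪ ψ.FV
  | all i φ => φ.FV.erase (2 * i)
  | ex i φ => φ.FV.erase (2 * i)

/-- A formula is a pre-formula in which no variable with even index is free. -/
def IsFormula (φ : PreFormula) : Prop := ∀ i ∈ φ.FV, Odd i

/-- A sentence is a formula without free variables. -/
def IsSentence (φ : PreFormula) : Prop := φ.FV = ∅

/-- Pre-formulas of the form `R t₁ t₂` or `¬ R t₁ t₂`. -/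
def IsLiteral : PreFormula → Prop
  | eq _ _ => True
  | neq _ _ => True
  | le _ _ => True
  | nle _ _ => True
  | _ => False

/-- Negation is a defined operation on pre-formulas in negation normal form. -/
def neg : PreFormula → PreFormula
  | eq s t => neq s t
  | neq s t => eq s t
  | le s t => nle s t
  | nle s t => le s t
  | and φ ψ => or φ.neg ψ.neg
  | or φ ψ => and φ.neg ψ.neg
  | all i φ => ex i φ.neg
  | ex i φ => all i φ.neg

/-- `φ → ψ` abbreviates `¬φ ∨ ψ`. -/
def imp (φ ψ : PreFormula) : PreFormula := or φ.neg ψ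

/-- `φ ↔ ψ` abbreviates `(φ → ψ) ∧ (ψ → φ)`. -/
def biimp (φ ψ : PreFormula) : PreFormula := and (imp φ ψ) (imp ψ φ)

/-- Falsity, as an atom in conjunction with its negation. -/
def bot : PreFormula := and (eq PreTerm.zero PreTerm.zero) (neq PreTerm.zero PreTerm.zero)

/-- `φ.subst i t` is `φ[v_i/t]`. It is only used when `t` is a term; then no variable of `t`
can be captured, since bound variables have even index. -/
def subst (φ : PreFormula) (i : ℕ) (t : PreTerm) : PreFormula :=
  match φ with
  | eq s₁ s₂ => eq (s₁.subst i t) (s₂.subst i t)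
  | neq s₁ s₂ => neq (s₁.subst i t) (s₂.subst i t)
  | le s₁ s₂ => le (s₁.subst i t) (s₂.subst i t)
  | nle s₁ s₂ => nle (s₁.subst i t) (s₂.subst i t)
  | and φ ψ => and (φ.subst i t) (ψ.subst i t)
  | or φ ψ => or (φ.subst i t) (ψ.subst i t)
  | all j φ => if i = 2 * j then all j φ else all j (φ.subst i t)
  | ex j φ => if i = 2 * j then ex j φ else ex j (φ.subst i t)

end PreFormula

/-! ### Sequent calculus -/

/-- A sequent is a finite set of formulas. -/
def IsSequent (Γ : Finset PreFormula) : Prop := ∀ φ ∈ Γ, φ.IsFormula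

/-- `Derivable Γ` is `⊢ Γ` in the Tait-style sequent calculus with cut, where the sequent `Γ`
is read as the disjunction of its elements. -/
inductive Derivable : Finset PreFormula → Prop
  | ax {Γ : Finset PreFormula} {φ : PreFormula} (hΓ : IsSequent Γ) (hφ : φ.IsLiteral)
      (h : φ ∈ Γ) (h_neg : φ.neg ∈ Γ) : Derivable Γ
  | and {Γ : Finset PreFormula} {φ ψ : PreFormula}
      (h₁ : Derivable (insert φ Γ)) (h₂ : Derivable (insert ψ Γ)) :
      Derivable (insert (PreFormula.and φ ψ) Γ)
  | or_left {Γ : Finset PreFormula} {φ ψ : PreFormula} (hψ : ψ.IsFormula)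
      (h : Derivable (insert φ Γ)) : Derivable (insert (PreFormula.or φ ψ) Γ)
  | or_right {Γ : Finset PreFormula} {φ ψ : PreFormula} (hφ : φ.IsFormula)
      (h : Derivable (insert ψ Γ)) : Derivable (insert (PreFormula.or φ ψ) Γ)
  | all {Γ Γ' : Finset PreFormula} {i y : ℕ} {φ : PreFormula} (hΓ : IsSequent Γ)
      (hsub : Γ' ⊆ Γ) (hy : Odd y) (hyΓ : ∀ ψ ∈ Γ', y ∉ ψ.FV)
      (hyφ : y ∉ (PreFormula.all i φ).FV)
      (h : Derivable (insert (φ.subst (2 * i) (PreTerm.var y)) Γ')) :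
      Derivable (insert (PreFormula.all i φ) Γ)
  | ex {Γ : Finset PreFormula} {i : ℕ} {φ : PreFormula} {t : PreTerm} (ht : t.IsTerm)
      (h : Derivable (insert (φ.subst (2 * i) t) Γ)) :
      Derivable (insert (PreFormula.ex i φ) Γ)
  | cut {Γ : Finset PreFormula} {φ : PreFormula}
      (h₁ : Derivable (insert φ Γ)) (h₂ : Derivable (insert φ.neg Γ)) : Derivable Γ

/-- `Proves T φ` is `T ⊢ φ`: the sequent `¬θ₁, …, ¬θₙ, φ` is derivable for some finitely many
axioms `θᵢ ∈ T`. -/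
def Proves (T : Set PreFormula) (φ : PreFormula) : Prop :=
  ∃ Δ : Finset PreFormula, (∀ θ ∈ Δ, θ ∈ T) ∧ Derivable (insert φ (Δ.image PreFormula.neg))

/-- A theory is a set of sentences. -/
def IsTheory (T : Set PreFormula) : Prop := ∀ θ ∈ T, θ.IsSentence

/-- `T` is consistent if it does not prove falsity. -/
def Consistent (T : Set PreFormula) : Prop := ¬ Proves T PreFormula.bot

/-! ### Robinson arithmetic -/

section Robinson

open PreTerm PreFormula

/-- The equality axioms for the signature of first-order arithmetic. -/
def eqAxioms : Set PreFormula :=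
  { -- reflexivity, symmetry, transitivity
    all 0 (eq (var 0) (var 0)),
    all 0 (all 1 (imp (eq (var 0) (var 2)) (eq (var 2) (var 0)))),
    all 0 (all 1 (all 2 (imp (and (eq (var 0) (var 2)) (eq (var 2) (var 4)))
      (eq (var 0) (var 4))))),
    -- the function symbols `0`, `S`, `+`, `×`
    eq zero zero,
    all 0 (all 1 (imp (eq (var 0) (var 2)) (eq (succ (var 0)) (succ (var 2))))),
    all 0 (all 1 (all 2 (all 3 (imp (and (eq (var 0) (var 4)) (eq (var 2) (var 6)))
      (eq (add (var 0) (var 2)) (add (var 4) (var 6))))))),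
    all 0 (all 1 (all 2 (all 3 (imp (and (eq (var 0) (var 4)) (eq (var 2) (var 6)))
      (eq (mul (var 0) (var 2)) (mul (var 4) (var 6))))))),
    -- the relation symbols `=`, `≤`
    all 0 (all 1 (all 2 (all 3 (imp (and (eq (var 0) (var 4)) (eq (var 2) (var 6)))
      (biimp (eq (var 0) (var 2)) (eq (var 4) (var 6))))))),
    all 0 (all 1 (all 2 (all 3 (imp (and (eq (var 0) (var 4)) (eq (var 2) (var 6)))
      (biimp (le (var 0) (var 2)) (le (var 4) (var 6))))))) }

/-- Robinson arithmetic: the equality axioms and the universal closures of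
`Sx = Sy → x = y`, `x ≠ 0 ↔ ∃ y, x = Sy`, `x ≤ y ↔ ∃ z, z + x = y`, `x + 0 = x`,
`x + Sy = S(x + y)`, `x × 0 = 0` and `x × Sy = (x × y) + x`,
with `x`, `y`, `z` the variables `v_0`, `v_2`, `v_4`. -/
def robinsonQ : Set PreFormula :=
  eqAxioms ∪
  { all 0 (all 1 (imp (eq (succ (var 0)) (succ (var 2))) (eq (var 0) (var 2)))),
    all 0 (biimp (neq (var 0) zero) (ex 1 (eq (var 0) (succ (var 2))))),
    all 0 (all 1 (biimp (le (var 0) (var 2)) (ex 2 (eq (add (var 4) (var 0)) (var 2))))),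
    all 0 (eq (add (var 0) zero) (var 0)),
    all 0 (all 1 (eq (add (var 0) (succ (var 2))) (succ (add (var 0) (var 2))))),
    all 0 (eq (mul (var 0) zero) zero),
    all 0 (all 1 (eq (mul (var 0) (succ (var 2))) (add (mul (var 0) (var 2)) (var 0)))) }

end Robinson

/-! ### Gödel numbers -/

/-- The Cantor pairing function. -/
def cantorPair (m n : ℕ) : ℕ := n + (m + n) * (m + n + 1) / 2

/-- Codes of finite sequences: `⟨⟩ = 0` and
`⟨a₀, …, aₙ⟩ = cantorPair ⟨a₀, …, aₙ₋₁⟩ aₙ + 1`. -/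
def seqCode (l : List ℕ) : ℕ := l.foldl (fun c a => cantorPair c a + 1) 0

/-- Gödel numbers of pre-terms. -/
def PreTerm.gn : PreTerm → ℕ
  | var i => seqCode [0, 0, i]
  | zero => seqCode [0, 1]
  | succ t => seqCode [0, 2, t.gn]
  | add s t => seqCode [0, 3, s.gn, t.gn]
  | mul s t => seqCode [0, 4, s.gn, t.gn]

/-- Gödel numbers of pre-formulas. -/
def PreFormula.gn : PreFormula → ℕ
  | eq s t => seqCode [1, 0, s.gn, t.gn]
  | neq s t => seqCode [1, 1, s.gn, t.gn]
  | le s t => seqCode [1, 2, s.gn, t.gn]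
  | nle s t => seqCode [1, 3, s.gn, t.gn]
  | and φ ψ => seqCode [1, 4, φ.gn, ψ.gn]
  | or φ ψ => seqCode [1, 5, φ.gn, ψ.gn]
  | all i φ => seqCode [1, 6, 2 * i, φ.gn]
  | ex i φ => seqCode [1, 7, 2 * i, φ.gn]

/-- `Pr.atCode y φ` is `Pr(⌜φ⌝)`: the numeral of the Gödel number of `φ` is substituted
for the variable `v_y` of `Pr`. -/
def PreFormula.atCode (Pr : PreFormula) (y : ℕ) (φ : PreFormula) : PreFormula :=
  Pr.subst y (numeral φ.gn)

/-- The Hilbert–Bernays conditions for a theory `T` and a formula `Pr(v_y)`. -/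
structure HilbertBernays (T : Set PreFormula) (Pr : PreFormula) (y : ℕ) : Prop where
  d1 : ∀ φ : PreFormula, φ.IsSentence → Proves T φ → Proves T (Pr.atCode y φ)
  d2 : ∀ φ : PreFormula, φ.IsSentence →
    Proves T ((Pr.atCode y φ).imp (Pr.atCode y (Pr.atCode y φ)))
  d3 : ∀ φ ψ : PreFormula, φ.IsSentence → ψ.IsSentence →
    Proves T (((Pr.atCode y (φ.imp ψ)).and (Pr.atCode y φ)).imp (Pr.atCode y ψ))

end FOArith

namespace FOArith

/-! ### Syntactic preliminaries -/

namespace PreTerm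

/-! Löb's theorem rests on a sentence ψ that `T` proves equivalent to Pr(⌜ψ⌝) → φ. Assume Pr(⌜ψ⌝).
D1 and D3 give Pr(⌜Pr(⌜ψ⌝) → φ⌝), D2 gives Pr(⌜Pr(⌜ψ⌝)⌝), so D3 gives Pr(⌜φ⌝), and φ follows by
assumption. Hence `T` proves ψ, then Pr(⌜ψ⌝) by D1, then φ. Part (b) is the case where φ is 0 = S0.

Reasoning inside `T` is replaced by reasoning in structures: by a Henkin construction
(`proves_of_forall_sat`), `T` proves each sentence that holds wherever all theorems of `T` hold.
Soundness of the calculus is never needed.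

The diagonal lemma (`exists_fixedPoint`) takes ψ to be ∃v_0 (v_0 = n ∧ χ), where n = ⌜χ⌝ and χ says
that θ holds of diag(v_0); here diag(n) = ⌜ψ⌝. Computing diag requires a recursion only for the
codes of numerals, which Gödel's β-function handles. A bounded formula expresses this; on numerals
its truth value is the same in all models of Q (`RobinsonModel.sat_num_iff`). Uniqueness of the
value, even against nonstandard witnesses, is built into `diagGraph`
(`RobinsonModel.sat_diagGraph`). -/

theorem subst_eq_self {s : PreTerm} {i : ℕ} (t : PreTerm) (h : i ∉ s.FV) : s.subst i t = s := by
  induction s <;> simp_all [FV, subst]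

theorem IsTerm.subst_even {s : PreTerm} (hs : s.IsTerm) (i : ℕ) (t : PreTerm) :
    s.subst (2 * i) t = s :=
  subst_eq_self t fun h => by have := hs _ h; grind

theorem FV_subst_subset (s : PreTerm) (i : ℕ) (t : PreTerm) :
    (s.subst i t).FV ⊆ s.FV.erase i ∪ t.FV := by
  intro x
  induction s <;> grind [FV, subst]

theorem FV_subset_subst (s : PreTerm) (i : ℕ) (t : PreTerm) :
    s.FV ⊆ insert i (s.subst i t).FV := by
  intro x
  induction s <;> grind [FV, subst]

/-- An injective numbering of pre-terms. -/
def toNat : PreTerm → ℕ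
  | var i => Nat.pair 0 i
  | zero => Nat.pair 1 0
  | succ t => Nat.pair 2 t.toNat
  | add s t => Nat.pair 3 (Nat.pair s.toNat t.toNat)
  | mul s t => Nat.pair 4 (Nat.pair s.toNat t.toNat)

theorem toNat_injective : Function.Injective toNat := by
  intro s
  induction s <;> intro t <;> cases t <;> simp_all [toNat, Nat.pair_eq_pair] <;>
    grind

end PreTerm

theorem FV_numeral (n : ℕ) : (numeral n).FV = ∅ := by
  induction n <;> simp_all [numeral, PreTerm.FV]

namespace PreFormula

theorem neg_neg (φ : PreFormula) : φ.neg.neg = φ := by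
  induction φ <;> simp_all [neg]

theorem FV_neg (φ : PreFormula) : φ.neg.FV = φ.FV := by
  induction φ <;> simp_all [neg, FV]

theorem neg_subst (φ : PreFormula) (i : ℕ) (t : PreTerm) :
    (φ.subst i t).neg = φ.neg.subst i t := by
  induction φ <;> simp_all [neg, subst] <;> split_ifs <;> simp_all [neg]

theorem isFormula_neg {φ : PreFormula} : φ.neg.IsFormula ↔ φ.IsFormula := by
  simp [IsFormula, FV_neg]

theorem IsSentence.isFormula {φ : PreFormula} (h : φ.IsSentence) : φ.IsFormula := by
  simp_all [IsFormula, IsSentence]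

theorem isFormula_and {φ ψ : PreFormula} :
    (and φ ψ).IsFormula ↔ φ.IsFormula ∧ ψ.IsFormula := by
  grind [IsFormula, FV]

theorem isFormula_or {φ ψ : PreFormula} :
    (or φ ψ).IsFormula ↔ φ.IsFormula ∧ ψ.IsFormula := by
  grind [IsFormula, FV]

theorem subst_eq_self {φ : PreFormula} {i : ℕ} (t : PreTerm) (h : i ∉ φ.FV) :
    φ.subst i t = φ := by
  induction φ <;> simp_all [FV, subst, PreTerm.subst_eq_self]

theorem FV_subst_subset (φ : PreFormula) (i : ℕ) (t : PreTerm) :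
    (φ.subst i t).FV ⊆ φ.FV.erase i ∪ t.FV := by
  intro x
  induction φ <;> grind [FV, subst, PreTerm.FV_subst_subset]

theorem FV_subset_subst (φ : PreFormula) (i : ℕ) (t : PreTerm) :
    φ.FV ⊆ insert i (φ.subst i t).FV := by
  intro x
  induction φ <;> grind [FV, subst, PreTerm.FV_subset_subst]

/-- Substitution for `v_{2i}` removes at most the variable that the quantifier binds. This makes the
conclusions of the quantifier rules sequents again. -/
theorem IsFormula.of_subst {φ : PreFormula} {i : ℕ} {t : PreTerm}
    (h : (φ.subst (2 * i) t).IsFormula) : (all i φ).IsFormula ∧ (ex i φ).IsFormula := by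
  have := FV_subset_subst φ (2 * i) t
  constructor <;> intro j hj <;> apply h <;> grind [FV]

theorem IsFormula.subst_all {φ : PreFormula} {i : ℕ} {t : PreTerm}
    (h : (all i φ).IsFormula) (ht : t.IsTerm) : (φ.subst (2 * i) t).IsFormula := by
  intro j hj
  have := FV_subst_subset φ (2 * i) t hj
  grind [FV, IsFormula, PreTerm.IsTerm]

theorem IsFormula.subst_ex {φ : PreFormula} {i : ℕ} {t : PreTerm}
    (h : (ex i φ).IsFormula) (ht : t.IsTerm) : (φ.subst (2 * i) t).IsFormula :=
  IsFormula.subst_all (φ := φ) h ht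

/-- The number of connectives and quantifiers. -/
def complexity : PreFormula → ℕ
  | eq _ _ => 0
  | neq _ _ => 0
  | le _ _ => 0
  | nle _ _ => 0
  | and φ ψ => φ.complexity + ψ.complexity + 1
  | or φ ψ => φ.complexity + ψ.complexity + 1
  | all _ φ => φ.complexity + 1
  | ex _ φ => φ.complexity + 1

theorem complexity_subst (φ : PreFormula) (i : ℕ) (t : PreTerm) :
    (φ.subst i t).complexity = φ.complexity := by
  induction φ <;> simp_all [subst, complexity] <;> split_ifs <;> simp_all [complexity]

/-- Indices of the bound variables of a pre-formula. -/
def BV : PreFormula → Finset ℕ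
  | eq _ _ => ∅
  | neq _ _ => ∅
  | le _ _ => ∅
  | nle _ _ => ∅
  | and φ ψ => φ.BV ∪ ψ.BV
  | or φ ψ => φ.BV ∪ ψ.BV
  | all i φ => insert (2 * i) φ.BV
  | ex i φ => insert (2 * i) φ.BV

theorem even_of_mem_BV {φ : PreFormula} {j : ℕ} (h : j ∈ φ.BV) : Even j := by
  induction φ <;> grind [BV]

/-- An injective numbering of pre-formulas. -/
def toNat : PreFormula → ℕ
  | eq s t => Nat.pair 0 (Nat.pair s.toNat t.toNat)
  | neq s t => Nat.pair 1 (Nat.pair s.toNat t.toNat)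
  | le s t => Nat.pair 2 (Nat.pair s.toNat t.toNat)
  | nle s t => Nat.pair 3 (Nat.pair s.toNat t.toNat)
  | and φ ψ => Nat.pair 4 (Nat.pair φ.toNat ψ.toNat)
  | or φ ψ => Nat.pair 5 (Nat.pair φ.toNat ψ.toNat)
  | all i φ => Nat.pair 6 (Nat.pair i φ.toNat)
  | ex i φ => Nat.pair 7 (Nat.pair i φ.toNat)

/-- Yields the countability that the Henkin construction uses to enumerate all formulas. -/
theorem toNat_injective : Function.Injective toNat := by
  intro φ
  induction φ <;> intro ψ <;> cases ψ <;>
    simp_all [toNat, Nat.pair_eq_pair, PreTerm.toNat_injective.eq_iff] <;> grind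

end PreFormula

/-! ### Semantics -/

/-- Structures for the language of first-order arithmetic. -/
class ArithStructure (M : Type) where
  zero : M
  succ : M → M
  add : M → M → M
  mul : M → M → M
  le : M → M → Prop

open ArithStructure Function

variable {M : Type} [ArithStructure M]

/-- The value of a pre-term under an assignment. -/
def PreTerm.eval (σ : ℕ → M) : PreTerm → M
  | var i => σ i
  | .zero => ArithStructure.zero
  | .succ t => ArithStructure.succ (t.eval σ)
  | .add s t => ArithStructure.add (s.eval σ) (t.eval σ)
  | .mul s t => ArithStructure.mul (s.eval σ) (t.eval σ)

/-- Satisfaction of a pre-formula under an assignment. -/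
def PreFormula.Sat : PreFormula → (ℕ → M) → Prop
  | eq s t, σ => s.eval σ = t.eval σ
  | neq s t, σ => s.eval σ ≠ t.eval σ
  | .le s t, σ => ArithStructure.le (s.eval σ) (t.eval σ)
  | nle s t, σ => ¬ ArithStructure.le (s.eval σ) (t.eval σ)
  | and φ ψ, σ => φ.Sat σ ∧ ψ.Sat σ
  | or φ ψ, σ => φ.Sat σ ∨ ψ.Sat σ
  | all i φ, σ => ∀ a, φ.Sat (update σ (2 * i) a)
  | ex i φ, σ => ∃ a, φ.Sat (update σ (2 * i) a)

theorem PreTerm.eval_congr {t : PreTerm} {σ τ : ℕ → M} (h : ∀ i ∈ t.FV, σ i = τ i) :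
    t.eval σ = t.eval τ := by
  induction t <;> simp_all [PreTerm.eval, FV]

theorem PreTerm.eval_subst (s : PreTerm) (i : ℕ) (t : PreTerm) (σ : ℕ → M) :
    (s.subst i t).eval σ = s.eval (update σ i (t.eval σ)) := by
  induction s with
  | var j =>
    by_cases h : i = j
    · subst h; simp [PreTerm.eval, subst]
    · simp [PreTerm.eval, subst, h, update_of_ne (Ne.symm h)]
  | _ => simp_all [PreTerm.eval, subst]

namespace PreFormula

theorem sat_congr {φ : PreFormula} {σ τ : ℕ → M} (h : ∀ i ∈ φ.FV, σ i = τ i) :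
    φ.Sat σ ↔ φ.Sat τ := by
  induction φ generalizing σ τ with
  | eq s t | neq s t | le s t | nle s t =>
    simp only [FV, Finset.mem_union] at h
    simp only [Sat, PreTerm.eval_congr fun i hi => h i (.inl hi),
      PreTerm.eval_congr fun i hi => h i (.inr hi)]
  | and φ ψ ihφ ihψ | or φ ψ ihφ ihψ =>
    simp only [FV, Finset.mem_union] at h
    simp only [Sat, ihφ fun i hi => h i (.inl hi), ihψ fun i hi => h i (.inr hi)]
  | all j φ ih =>
    refine forall_congr' fun a => ih fun i hi => ?_
    grind [FV, update]
  | ex j φ ih =>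
    refine exists_congr fun a => ih fun i hi => ?_
    grind [FV, update]

theorem sat_neg (φ : PreFormula) (σ : ℕ → M) : φ.neg.Sat σ ↔ ¬ φ.Sat σ := by
  induction φ generalizing σ <;> simp_all [neg, Sat]; tauto

theorem sat_imp (φ ψ : PreFormula) (σ : ℕ → M) : (φ.imp ψ).Sat σ ↔ (φ.Sat σ → ψ.Sat σ) := by
  simp only [imp, Sat, sat_neg]; tauto

theorem sat_biimp (φ ψ : PreFormula) (σ : ℕ → M) :
    (φ.biimp ψ).Sat σ ↔ (φ.Sat σ ↔ ψ.Sat σ) := by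
  simp only [biimp, Sat, sat_imp]; tauto

/-- The hypothesis is weaker than `t.IsTerm` because the diagonal lemma substitutes a variable of
even index. -/
theorem sat_subst {φ : PreFormula} {i : ℕ} {t : PreTerm} (h : ∀ j ∈ φ.BV, j ∉ t.FV)
    (σ : ℕ → M) : (φ.subst i t).Sat σ ↔ φ.Sat (update σ i (t.eval σ)) := by
  induction φ generalizing σ with
  | eq | neq | le | nle => simp [subst, Sat, PreTerm.eval_subst]
  | and φ ψ ihφ ihψ | or φ ψ ihφ ihψ =>
    simp only [BV, Finset.mem_union] at h
    simp only [subst, Sat, ihφ fun j hj => h j (.inl hj), ihψ fun j hj => h j (.inr hj)]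
  | all j φ ih | ex j φ ih =>
    simp only [BV, Finset.mem_insert, forall_eq_or_imp] at h
    by_cases hij : i = 2 * j
    · simp [subst, Sat, hij]
    · have (a : M) : t.eval (update σ (2 * j) a) = t.eval σ :=
        PreTerm.eval_congr fun k hk => by
          rw [update_of_ne]; rintro rfl; exact h.1 hk
      simp only [subst, hij, if_false, Sat, ih h.2, this, update_comm hij]

theorem sat_subst_of_isTerm {φ : PreFormula} {i : ℕ} {t : PreTerm} (ht : t.IsTerm)
    (σ : ℕ → M) : (φ.subst i t).Sat σ ↔ φ.Sat (update σ i (t.eval σ)) :=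
  sat_subst (fun j hj hjt => by have := even_of_mem_BV hj; have := ht j hjt; grind) σ

end PreFormula

/-! ### Derivations -/

theorem isSequent_insert {φ : PreFormula} {Γ : Finset PreFormula} :
    IsSequent (insert φ Γ) ↔ φ.IsFormula ∧ IsSequent Γ := by
  simp [IsSequent]

namespace Derivable

theorem isSequent {Γ : Finset PreFormula} (h : Derivable Γ) : IsSequent Γ := by
  induction h with
  | ax hΓ => exact hΓ
  | and _ _ ih₁ ih₂ =>
    simp only [isSequent_insert, PreFormula.isFormula_and] at *; tauto
  | or_left hψ _ ih | or_right hψ _ ih =>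
    simp only [isSequent_insert, PreFormula.isFormula_or] at *; tauto
  | all hΓ _ _ _ _ _ ih =>
    exact isSequent_insert.2 ⟨(isSequent_insert.1 ih).1.of_subst.1, hΓ⟩
  | ex _ _ ih =>
    exact isSequent_insert.2 ⟨(isSequent_insert.1 ih).1.of_subst.2, (isSequent_insert.1 ih).2⟩
  | cut _ _ ih => exact (isSequent_insert.1 ih).2

/-- The eigenvariable condition of the rule `all` concerns only the subset `Γ'` of the side
formulas, so weakening needs no renaming of variables. -/
theorem mono {Γ Δ : Finset PreFormula} (h : Derivable Γ) (hΓ : Γ ⊆ Δ) (hΔ : IsSequent Δ) :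
    Derivable Δ := by
  induction h generalizing Δ with
  | ax _ hφ h h_neg => exact ax hΔ hφ (hΓ h) (hΓ h_neg)
  | and _ _ ih₁ ih₂ =>
    obtain ⟨h, hΓ'⟩ := Finset.insert_subset_iff.1 hΓ
    have hf := PreFormula.isFormula_and.1 (hΔ _ h)
    rw [← Finset.insert_eq_of_mem h]
    exact and (ih₁ (Finset.insert_subset_insert _ hΓ') (isSequent_insert.2 ⟨hf.1, hΔ⟩))
      (ih₂ (Finset.insert_subset_insert _ hΓ') (isSequent_insert.2 ⟨hf.2, hΔ⟩))
  | or_left hψ _ ih =>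
    obtain ⟨h, hΓ'⟩ := Finset.insert_subset_iff.1 hΓ
    have hf := PreFormula.isFormula_or.1 (hΔ _ h)
    rw [← Finset.insert_eq_of_mem h]
    exact or_left hψ (ih (Finset.insert_subset_insert _ hΓ') (isSequent_insert.2 ⟨hf.1, hΔ⟩))
  | or_right hψ _ ih =>
    obtain ⟨h, hΓ'⟩ := Finset.insert_subset_iff.1 hΓ
    have hf := PreFormula.isFormula_or.1 (hΔ _ h)
    rw [← Finset.insert_eq_of_mem h]
    exact or_right hψ (ih (Finset.insert_subset_insert _ hΓ') (isSequent_insert.2 ⟨hf.2, hΔ⟩))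
  | all _ hsub hy hyΓ hyφ h' _ =>
    obtain ⟨h, hΓ'⟩ := Finset.insert_subset_iff.1 hΓ
    rw [← Finset.insert_eq_of_mem h]
    exact all hΔ (hsub.trans hΓ') hy hyΓ hyφ h'
  | ex ht _ ih =>
    obtain ⟨h, hΓ'⟩ := Finset.insert_subset_iff.1 hΓ
    rw [← Finset.insert_eq_of_mem h]
    exact ex ht (ih (Finset.insert_subset_insert _ hΓ')
      (isSequent_insert.2 ⟨(hΔ _ h).subst_ex ht, hΔ⟩))
  | cut h₁ _ ih₁ ih₂ =>
    have hf := (isSequent_insert.1 h₁.isSequent).1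
    exact cut (ih₁ (Finset.insert_subset_insert _ hΓ) (isSequent_insert.2 ⟨hf, hΔ⟩))
      (ih₂ (Finset.insert_subset_insert _ hΓ)
        (isSequent_insert.2 ⟨PreFormula.isFormula_neg.2 hf, hΔ⟩))

end Derivable

theorem isTerm_var {y : ℕ} (hy : Odd y) : (PreTerm.var y).IsTerm := by
  simpa [PreTerm.IsTerm, PreTerm.FV] using hy

/-- Excluded middle for arbitrary formulas. -/
theorem derivable_em {φ : PreFormula} (hφ : φ.IsFormula) : Derivable {φ, φ.neg} := by
  induction hn : φ.complexity using Nat.strong_induction_on generalizing φ with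
  | _ n ih =>
  have lit (hl : φ.IsLiteral) : Derivable {φ, φ.neg} :=
    .ax (by simp [IsSequent, hφ, PreFormula.isFormula_neg]) hl
      (by simp) (by simp)
  subst hn
  cases φ with
  | eq | neq | le | nle => exact lit trivial
  | and φ ψ =>
    obtain ⟨h₁, h₂⟩ := PreFormula.isFormula_and.1 hφ
    have n₁ := PreFormula.isFormula_neg.2 h₁
    have n₂ := PreFormula.isFormula_neg.2 h₂
    refine .and ?_ ?_
    · have := ih _ (by simp [PreFormula.complexity]) h₁ rfl
      rw [Finset.pair_comm] at this ⊢
      exact .or_left n₂ this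
    · have := ih _ (by simp [PreFormula.complexity]) h₂ rfl
      rw [Finset.pair_comm] at this ⊢
      exact .or_right n₁ this
  | or φ ψ =>
    obtain ⟨h₁, h₂⟩ := PreFormula.isFormula_or.1 hφ
    rw [Finset.pair_comm]
    refine .and ?_ ?_
    · have := ih _ (by simp [PreFormula.complexity]) h₁ rfl
      rw [Finset.pair_comm]
      exact .or_left h₂ this
    · have := ih _ (by simp [PreFormula.complexity]) h₂ rfl
      rw [Finset.pair_comm]
      exact .or_right h₁ this
  | all i φ =>
    -- The index `2 * sup + 1` is odd and exceeds every free index.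
    obtain ⟨y, hy, hyφ⟩ : ∃ y, Odd y ∧ y ∉ (PreFormula.all i φ).FV :=
      ⟨2 * (PreFormula.all i φ).FV.sup id + 1, ⟨_, rfl⟩, fun h => by
        have := id_eq (α := ℕ) _ ▸ Finset.le_sup (f := id) h; omega⟩
    have hn : (PreFormula.all i φ).neg.IsFormula := PreFormula.isFormula_neg.2 hφ
    refine .all (Γ' := {(PreFormula.all i φ).neg}) (by simpa [IsSequent] using hn)
      subset_rfl hy (by simpa [PreFormula.FV_neg] using hyφ) hyφ ?_
    have := ih _ (by simp [PreFormula.complexity, PreFormula.complexity_subst])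
      (hφ.subst_all (isTerm_var hy)) rfl
    rw [Finset.pair_comm] at this ⊢
    rw [PreFormula.neg_subst] at this
    exact .ex (isTerm_var hy) this
  | ex i φ =>
    obtain ⟨y, hy, hyφ⟩ : ∃ y, Odd y ∧ y ∉ (PreFormula.ex i φ).FV :=
      ⟨2 * (PreFormula.ex i φ).FV.sup id + 1, ⟨_, rfl⟩, fun h => by
        have := id_eq (α := ℕ) _ ▸ Finset.le_sup (f := id) h; omega⟩
    rw [Finset.pair_comm]
    refine .all (Γ' := {PreFormula.ex i φ}) (by simpa [IsSequent] using hφ)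
      subset_rfl hy (by simpa using hyφ) ?_ ?_
    · simpa [PreFormula.FV, PreFormula.FV_neg] using hyφ
    have := ih _ (by simp [PreFormula.complexity, PreFormula.complexity_subst])
      (hφ.subst_ex (isTerm_var hy)) rfl
    rw [PreFormula.neg_subst] at this
    rw [Finset.pair_comm]
    exact .ex (isTerm_var hy) this

/-! ### Maximal consistent sets -/

/-- No finite subset of `X` is refutable. -/
def Irrefutable (X : Set PreFormula) : Prop :=
  ∀ Δ : Finset PreFormula, ↑Δ ⊆ X → ¬ Derivable (Δ.image PreFormula.neg)

theorem isSequent_image_neg {Δ : Finset PreFormula} {X : Set PreFormula} (h : ↑Δ ⊆ X)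
    (hX : ∀ φ ∈ X, φ.IsFormula) : IsSequent (Δ.image PreFormula.neg) := by
  intro φ hφ
  obtain ⟨ψ, hψ, rfl⟩ := Finset.mem_image.1 hφ
  exact PreFormula.isFormula_neg.2 (hX _ (h hψ))

/-- Adding a formula to a set makes it refutable only if the set proves its negation. -/
theorem exists_derivable_of_not_irrefutable {X : Set PreFormula} (hX : ∀ φ ∈ X, φ.IsFormula)
    {φ : PreFormula} (hφ : φ.IsFormula) (h : ¬ Irrefutable (insert φ X)) :
    ∃ Δ : Finset PreFormula, ↑Δ ⊆ X ∧ Derivable (insert φ.neg (Δ.image PreFormula.neg)) := by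
  simp only [Irrefutable, not_forall, not_not] at h
  obtain ⟨Δ, hΔ, hd⟩ := h
  have hΔ' : ↑(Δ.erase φ) ⊆ X := by
    intro ψ hψ
    simp only [Finset.coe_erase, Set.mem_sdiff, Finset.mem_coe, Set.mem_singleton_iff] at hψ
    exact (hΔ hψ.1).resolve_left hψ.2
  refine ⟨Δ.erase φ, hΔ', hd.mono ?_
    (isSequent_insert.2 ⟨PreFormula.isFormula_neg.2 hφ, isSequent_image_neg hΔ' hX⟩)⟩
  rw [← Finset.image_insert]
  exact Finset.image_subset_image (Finset.insert_erase_subset φ Δ)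

/-- Irrefutable sets of formulas with boundedly many free variables. -/
structure Extendable (X : Set PreFormula) : Prop where
  isFormula : ∀ φ ∈ X, φ.IsFormula
  irrefutable : Irrefutable X
  bounded : ∃ N, ∀ φ ∈ X, ∀ i ∈ φ.FV, i < N

theorem Extendable.insert {X : Set PreFormula} (hX : Extendable X) {φ : PreFormula}
    (hφ : φ.IsFormula) (h : Irrefutable (insert φ X)) : Extendable (insert φ X) := by
  obtain ⟨N, hN⟩ := hX.bounded
  refine ⟨by simpa [hφ] using hX.isFormula, h, max N (φ.FV.sup id + 1), ?_⟩
  rintro ψ (rfl | hψ) i hi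
  · have := Finset.le_sup (f := id) hi
    simp at this ⊢
    omega
  · exact lt_max_of_lt_left (hN ψ hψ i hi)

/-- All free indices in `X` are below `N`, so `v_{2N+1}` is fresh. If the instance at this variable
were refutable, the rule `all` would refute the existential formula itself, which lies in `X`. -/
theorem Extendable.insert_witness {X : Set PreFormula} (hX : Extendable X) {i : ℕ}
    {φ : PreFormula} (hφ : PreFormula.ex i φ ∈ X) :
    ∃ t : PreTerm, t.IsTerm ∧ Extendable (Insert.insert (φ.subst (2 * i) t) X) := by
  obtain ⟨N, hN⟩ := hX.bounded
  have hy : Odd (2 * N + 1) := ⟨N, rfl⟩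
  have hf := (hX.isFormula _ hφ).subst_ex (isTerm_var hy)
  have hfresh : ∀ ψ ∈ X, 2 * N + 1 ∉ ψ.FV := fun ψ hψ h => by
    have := hN ψ hψ _ h; omega
  refine ⟨_, isTerm_var hy, hX.insert hf (by_contra fun h => ?_)⟩
  obtain ⟨Δ, hΔ, hd⟩ := exists_derivable_of_not_irrefutable hX.isFormula hf h
  rw [PreFormula.neg_subst] at hd
  have := Derivable.all (isSequent_image_neg hΔ hX.isFormula) subset_rfl hy
    (fun ψ hψ => ?_) ?_ hd
  · refine hX.irrefutable (Insert.insert (PreFormula.ex i φ) Δ) ?_ ?_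
    · simpa [Set.insert_subset_iff] using ⟨hφ, hΔ⟩
    · rwa [Finset.image_insert]
  · obtain ⟨θ, hθ, rfl⟩ := Finset.mem_image.1 hψ
    simpa [PreFormula.FV_neg] using hfresh θ (hΔ hθ)
  · simpa [PreFormula.FV, PreFormula.FV_neg] using hfresh _ hφ

/-- One stage of the construction: `φ` is decided and, if existential and accepted, receives a
witness at once. -/
theorem Extendable.exists_extension {X : Set PreFormula} (hX : Extendable X)
    (φ : PreFormula) : ∃ Y, X ⊆ Y ∧ Extendable Y ∧
      (φ.IsFormula → φ ∈ Y ∨ ¬ Irrefutable (Insert.insert φ X)) ∧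
      ∀ i ψ, φ = .ex i ψ → φ ∈ Y → ∃ t : PreTerm, t.IsTerm ∧ ψ.subst (2 * i) t ∈ Y := by
  by_cases hφ : φ.IsFormula ∧ Irrefutable (Insert.insert φ X)
  · have hY := hX.insert hφ.1 hφ.2
    by_cases hex : ∃ i ψ, φ = .ex i ψ
    · obtain ⟨i, ψ, rfl⟩ := hex
      obtain ⟨t, ht, hZ⟩ := hY.insert_witness (Set.mem_insert _ _)
      refine ⟨_, (Set.subset_insert _ _).trans (Set.subset_insert _ _), hZ, by simp, ?_⟩
      rintro _ _ ⟨⟩ -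
      exact ⟨t, ht, Set.mem_insert _ _⟩
    · exact ⟨_, Set.subset_insert _ _, hY, by simp, fun i ψ h => (hex ⟨i, ψ, h⟩).elim⟩
  · by_cases hex : ∃ i ψ, φ = .ex i ψ ∧ φ ∈ X
    · obtain ⟨i, ψ, rfl, hmem⟩ := hex
      obtain ⟨t, ht, hZ⟩ := hX.insert_witness hmem
      refine ⟨_, Set.subset_insert _ _, hZ, by tauto, ?_⟩
      rintro _ _ ⟨⟩ -
      exact ⟨t, ht, Set.mem_insert _ _⟩
    · exact ⟨X, subset_rfl, hX, by tauto, fun i ψ h h' => (hex ⟨i, ψ, h, h'⟩).elim⟩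

theorem Irrefutable.mono {X Y : Set PreFormula} (hY : Irrefutable Y) (h : X ⊆ Y) :
    Irrefutable X := fun Δ hΔ => hY Δ (hΔ.trans h)

/-- Maximal irrefutable sets of formulas with witnesses for existential formulas. -/
structure HenkinSet (X : Set PreFormula) : Prop where
  isFormula : ∀ φ ∈ X, φ.IsFormula
  irrefutable : Irrefutable X
  maximal : ∀ φ : PreFormula, φ.IsFormula → φ ∈ X ∨ ¬ Irrefutable (insert φ X)
  witness : ∀ i φ, PreFormula.ex i φ ∈ X → ∃ t : PreTerm, t.IsTerm ∧ φ.subst (2 * i) t ∈ X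

theorem Extendable.exists_henkinSet {X : Set PreFormula} (hX : Extendable X) :
    ∃ Y, X ⊆ Y ∧ HenkinSet Y := by
  have : Countable PreFormula := PreFormula.toNat_injective.countable
  have : Nonempty PreFormula := ⟨.bot⟩
  obtain ⟨e, he⟩ := exists_surjective_nat PreFormula
  choose! F hsub hext hmax hwit using
    fun (X : Set PreFormula) (hX : Extendable X) => hX.exists_extension
  let Y : ℕ → Set PreFormula := fun n => Nat.rec X (fun n Z => F Z (e n)) n
  have hY (n : ℕ) : Extendable (Y n) := by
    induction n with
    | zero => exact hX
    | succ n ih => exact hext _ ih _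
  have hmono : Monotone Y := monotone_nat_of_le_succ fun n => hsub _ (hY n) _
  refine ⟨⋃ n, Y n, Set.subset_iUnion Y 0, ?_, ?_, ?_, ?_⟩
  · intro φ hφ
    obtain ⟨n, hn⟩ := Set.mem_iUnion.1 hφ
    exact (hY n).isFormula φ hn
  · intro Δ hΔ
    obtain ⟨n, hn⟩ := Directed.exists_mem_subset_of_finset_subset_biUnion
      (s := Δ) (hmono.directed_le) hΔ
    exact (hY n).irrefutable Δ hn
  · intro φ hφ
    obtain ⟨n, rfl⟩ := he φ
    refine (hmax _ (hY n) _ hφ).imp (fun h => Set.mem_iUnion.2 ⟨n + 1, h⟩) fun h h' => h ?_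
    exact h'.mono (Set.insert_subset_insert (Set.subset_iUnion Y n))
  · intro i φ hφ
    obtain ⟨n, hn⟩ := he (PreFormula.ex i φ)
    by_cases hmem : PreFormula.ex i φ ∈ F (Y n) (e n)
    · obtain ⟨t, ht, h⟩ := hwit _ (hY n) _ i φ hn (hn ▸ hmem)
      exact ⟨t, ht, Set.mem_iUnion.2 ⟨n + 1, h⟩⟩
    -- Had the formula been rejected at its own stage, it would be refutable over `Y n`; but it
    -- enters some `Y m`, and `Y (max m n)` is irrefutable.
    · refine ((hmax _ (hY n) _ (hn ▸ (?_ : (PreFormula.ex i φ).IsFormula))).elim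
        (fun h => (hmem (hn ▸ h)).elim) fun h => (h ?_).elim)
      · obtain ⟨m, hm⟩ := Set.mem_iUnion.1 hφ
        refine (hY (max m n)).irrefutable.mono (Set.insert_subset ?_ (hmono (le_max_right _ _)))
        exact hn ▸ hmono (le_max_left _ _) hm
      · obtain ⟨m, hm⟩ := Set.mem_iUnion.1 hφ
        exact (hY m).isFormula _ hm

/-! ### Closure properties of Henkin sets -/

namespace HenkinSet

variable {X : Set PreFormula} (hX : HenkinSet X)
include hX

/-- Henkin sets are closed under derivability. -/
theorem mem_of_derivable {φ : PreFormula} {Δ : Finset PreFormula} (hΔ : ↑Δ ⊆ X)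
    (h : Derivable (insert φ (Δ.image PreFormula.neg))) : φ ∈ X := by
  have hφ := (isSequent_insert.1 h.isSequent).1
  refine (hX.maximal φ hφ).resolve_right fun h' => ?_
  obtain ⟨Δ', hΔ', hd⟩ := exists_derivable_of_not_irrefutable hX.isFormula hφ h'
  have hsub : ↑(Δ ∪ Δ') ⊆ X := by simp [hΔ, hΔ']
  have hs := isSequent_image_neg hsub hX.isFormula
  refine hX.irrefutable (Δ ∪ Δ') hsub (.cut (φ := φ) (h.mono ?_ ?_) (hd.mono ?_ ?_))
  · exact Finset.insert_subset_insert _ (Finset.image_subset_image Finset.subset_union_left)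
  · exact isSequent_insert.2 ⟨hφ, hs⟩
  · exact Finset.insert_subset_insert _ (Finset.image_subset_image Finset.subset_union_right)
  · exact isSequent_insert.2 ⟨PreFormula.isFormula_neg.2 hφ, hs⟩

theorem neg_mem {φ : PreFormula} (hφ : φ.IsFormula) (h : φ ∉ X) : φ.neg ∈ X := by
  obtain ⟨Δ, hΔ, hd⟩ := exists_derivable_of_not_irrefutable hX.isFormula hφ
    ((hX.maximal φ hφ).resolve_left h)
  exact hX.mem_of_derivable hΔ hd

theorem not_mem_neg {φ : PreFormula} (h : φ ∈ X) : φ.neg ∉ X := fun h' => by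
  refine hX.irrefutable {φ, φ.neg} (by simp [Set.insert_subset_iff, h, h']) ?_
  simpa [PreFormula.neg_neg, Finset.pair_comm] using derivable_em (hX.isFormula _ h)

theorem and_mem {φ ψ : PreFormula} (h : PreFormula.and φ ψ ∈ X) : φ ∈ X ∧ ψ ∈ X := by
  obtain ⟨hφ, hψ⟩ := PreFormula.isFormula_and.1 (hX.isFormula _ h)
  constructor
  · refine hX.mem_of_derivable (Δ := {.and φ ψ}) (by simpa using h) ?_
    have := derivable_em hφ
    rw [Finset.image_singleton, Finset.pair_comm] at *
    exact .or_left (PreFormula.isFormula_neg.2 hψ) this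
  · refine hX.mem_of_derivable (Δ := {.and φ ψ}) (by simpa using h) ?_
    have := derivable_em hψ
    rw [Finset.image_singleton, Finset.pair_comm] at *
    exact .or_right (PreFormula.isFormula_neg.2 hφ) this

/-- Otherwise `X` contains φ ∨ ψ, ¬φ and ¬ψ, which are jointly refuted by the rule `and` applied to
two instances of excluded middle. -/
theorem or_mem {φ ψ : PreFormula} (h : PreFormula.or φ ψ ∈ X) : φ ∈ X ∨ ψ ∈ X := by
  obtain ⟨hφ, hψ⟩ := PreFormula.isFormula_or.1 (hX.isFormula _ h)
  by_contra! hn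
  refine hX.irrefutable {.or φ ψ, φ.neg, ψ.neg} ?_ ?_
  · simp [Set.insert_subset_iff, h, hX.neg_mem hφ hn.1, hX.neg_mem hψ hn.2]
  · simp only [Finset.image_insert, Finset.image_singleton, PreFormula.neg_neg]
    have nφ := PreFormula.isFormula_neg.2 hφ
    have nψ := PreFormula.isFormula_neg.2 hψ
    refine .and ((derivable_em hφ).mono (by grind) ?_) ((derivable_em hψ).mono (by grind) ?_) <;>
    simp [IsSequent, hφ, hψ, nφ, nψ]

theorem all_mem {i : ℕ} {φ : PreFormula} (h : PreFormula.all i φ ∈ X) {t : PreTerm}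
    (ht : t.IsTerm) : φ.subst (2 * i) t ∈ X := by
  refine hX.mem_of_derivable (Δ := {.all i φ}) (by simpa using h) ?_
  have := derivable_em ((hX.isFormula _ h).subst_all ht)
  rw [Finset.image_singleton, Finset.pair_comm]
  rw [Finset.pair_comm, PreFormula.neg_subst] at this
  exact .ex ht this

theorem imp_mem {φ ψ : PreFormula} (h : φ.imp ψ ∈ X) (hφ : φ ∈ X) : ψ ∈ X :=
  (hX.or_mem h).resolve_left (hX.not_mem_neg hφ)

theorem and_mem_iff {φ ψ : PreFormula} : PreFormula.and φ ψ ∈ X ↔ φ ∈ X ∧ ψ ∈ X := by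
  refine ⟨hX.and_mem, fun ⟨h₁, h₂⟩ => by_contra fun h => ?_⟩
  have := hX.or_mem (hX.neg_mem
    (PreFormula.isFormula_and.2 ⟨hX.isFormula _ h₁, hX.isFormula _ h₂⟩) h)
  exact this.elim (hX.not_mem_neg h₁) (hX.not_mem_neg h₂)

end HenkinSet

/-! ### The term model and completeness -/

/-- Terms, that is, pre-terms without free variables of even index. -/
abbrev Term : Type := {t : PreTerm // t.IsTerm}

theorem isTerm_zero : PreTerm.zero.IsTerm := by simp [PreTerm.IsTerm, PreTerm.FV]

theorem isTerm_succ {t : PreTerm} : t.succ.IsTerm ↔ t.IsTerm := Iff.rfl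

theorem isTerm_add {s t : PreTerm} : (s.add t).IsTerm ↔ s.IsTerm ∧ t.IsTerm := by
  grind [PreTerm.IsTerm, PreTerm.FV]

theorem isTerm_mul {s t : PreTerm} : (s.mul t).IsTerm ↔ s.IsTerm ∧ t.IsTerm := by
  grind [PreTerm.IsTerm, PreTerm.FV]

theorem isTerm_numeral (n : ℕ) : (numeral n).IsTerm := by
  simp [PreTerm.IsTerm, FV_numeral]

/-! ### Equality in Henkin sets and the term model -/

namespace HenkinSet

variable {X : Set PreFormula} (hX : HenkinSet X) (hE : eqAxioms ⊆ X)
include hX hE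

theorem eq_refl {s : PreTerm} (hs : s.IsTerm) : .eq s s ∈ X := by
  have h : .all 0 (.eq (.var 0) (.var 0)) ∈ X := hE (by simp [eqAxioms])
  simpa [PreFormula.subst, PreTerm.subst] using hX.all_mem h hs

theorem eq_symm {s t : PreTerm} (hs : s.IsTerm) (ht : t.IsTerm) (h : .eq s t ∈ X) :
    .eq t s ∈ X := by
  have h₀ : .all 0 (.all 1 (.imp (.eq (.var 0) (.var 2)) (.eq (.var 2) (.var 0)))) ∈ X :=
    hE (by simp [eqAxioms])
  have h₁ := hX.all_mem h₀ hs
  simp only [PreFormula.subst, PreFormula.imp, PreFormula.neg, PreTerm.subst] at h₁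
  have h₂ := hX.all_mem h₁ ht
  simp [PreFormula.subst, PreTerm.subst, hs.subst_even 1] at h₂
  exact hX.imp_mem (φ := .eq s t) h₂ h

theorem eq_trans {s t u : PreTerm} (hs : s.IsTerm) (ht : t.IsTerm) (hu : u.IsTerm)
    (h : .eq s t ∈ X) (h' : .eq t u ∈ X) : .eq s u ∈ X := by
  have h₀ : .all 0 (.all 1 (.all 2 (.imp (.and (.eq (.var 0) (.var 2)) (.eq (.var 2) (.var 4)))
      (.eq (.var 0) (.var 4))))) ∈ X := hE (by simp [eqAxioms])
  have h₁ := hX.all_mem h₀ hs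
  simp [PreFormula.subst, PreFormula.imp, PreFormula.neg, PreTerm.subst] at h₁
  have h₂ := hX.all_mem h₁ ht
  simp [PreFormula.subst, PreTerm.subst, hs.subst_even 1] at h₂
  have h₃ := hX.all_mem h₂ hu
  simp [PreFormula.subst, PreTerm.subst, hs.subst_even 2, ht.subst_even 2] at h₃
  exact hX.imp_mem (φ := .and (.eq s t) (.eq t u)) h₃ (hX.and_mem_iff.2 ⟨h, h'⟩)

theorem eq_succ {s t : PreTerm} (hs : s.IsTerm) (ht : t.IsTerm) (h : .eq s t ∈ X) :
    .eq s.succ t.succ ∈ X := by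
  have h₀ : .all 0 (.all 1 (.imp (.eq (.var 0) (.var 2))
      (.eq (.succ (.var 0)) (.succ (.var 2))))) ∈ X := hE (by simp [eqAxioms])
  have h₁ := hX.all_mem h₀ hs
  simp [PreFormula.subst, PreFormula.imp, PreFormula.neg, PreTerm.subst] at h₁
  have h₂ := hX.all_mem h₁ ht
  simp [PreFormula.subst, PreTerm.subst, hs.subst_even 1] at h₂
  exact hX.imp_mem (φ := .eq s t) h₂ h

theorem eq_add {s t u v : PreTerm} (hs : s.IsTerm) (ht : t.IsTerm) (hu : u.IsTerm)
    (hv : v.IsTerm) (h : .eq s u ∈ X) (h' : .eq t v ∈ X) : .eq (.add s t) (.add u v) ∈ X := by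
  have h₀ : .all 0 (.all 1 (.all 2 (.all 3 (.imp (.and (.eq (.var 0) (.var 4))
      (.eq (.var 2) (.var 6))) (.eq (.add (.var 0) (.var 2)) (.add (.var 4) (.var 6))))))) ∈ X :=
    hE (by simp [eqAxioms])
  have h₁ := hX.all_mem h₀ hs
  simp [PreFormula.subst, PreFormula.imp, PreFormula.neg, PreTerm.subst] at h₁
  have h₂ := hX.all_mem h₁ ht
  simp [PreFormula.subst, PreTerm.subst, hs.subst_even 1] at h₂
  have h₃ := hX.all_mem h₂ hu
  simp [PreFormula.subst, PreTerm.subst, hs.subst_even 2, ht.subst_even 2] at h₃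
  have h₄ := hX.all_mem h₃ hv
  simp [PreFormula.subst, PreTerm.subst, hs.subst_even 3, ht.subst_even 3, hu.subst_even 3] at h₄
  exact hX.imp_mem (φ := .and (.eq s u) (.eq t v)) h₄ (hX.and_mem_iff.2 ⟨h, h'⟩)

theorem eq_mul {s t u v : PreTerm} (hs : s.IsTerm) (ht : t.IsTerm) (hu : u.IsTerm)
    (hv : v.IsTerm) (h : .eq s u ∈ X) (h' : .eq t v ∈ X) : .eq (.mul s t) (.mul u v) ∈ X := by
  have h₀ : .all 0 (.all 1 (.all 2 (.all 3 (.imp (.and (.eq (.var 0) (.var 4))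
      (.eq (.var 2) (.var 6))) (.eq (.mul (.var 0) (.var 2)) (.mul (.var 4) (.var 6))))))) ∈ X :=
    hE (by simp [eqAxioms])
  have h₁ := hX.all_mem h₀ hs
  simp [PreFormula.subst, PreFormula.imp, PreFormula.neg, PreTerm.subst] at h₁
  have h₂ := hX.all_mem h₁ ht
  simp [PreFormula.subst, PreTerm.subst, hs.subst_even 1] at h₂
  have h₃ := hX.all_mem h₂ hu
  simp [PreFormula.subst, PreTerm.subst, hs.subst_even 2, ht.subst_even 2] at h₃
  have h₄ := hX.all_mem h₃ hv
  simp [PreFormula.subst, PreTerm.subst, hs.subst_even 3, ht.subst_even 3, hu.subst_even 3] at h₄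
  exact hX.imp_mem (φ := .and (.eq s u) (.eq t v)) h₄ (hX.and_mem_iff.2 ⟨h, h'⟩)

theorem le_congr {s t u v : PreTerm} (hs : s.IsTerm) (ht : t.IsTerm) (hu : u.IsTerm)
    (hv : v.IsTerm) (h : .eq s u ∈ X) (h' : .eq t v ∈ X) (hle : .le s t ∈ X) :
    .le u v ∈ X := by
  have h₀ : .all 0 (.all 1 (.all 2 (.all 3 (.imp (.and (.eq (.var 0) (.var 4))
      (.eq (.var 2) (.var 6))) (.biimp (.le (.var 0) (.var 2)) (.le (.var 4) (.var 6))))))) ∈ X :=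
    hE (by simp [eqAxioms])
  have h₁ := hX.all_mem h₀ hs
  simp [PreFormula.subst, PreFormula.imp, PreFormula.biimp, PreFormula.neg, PreTerm.subst] at h₁
  have h₂ := hX.all_mem h₁ ht
  simp [PreFormula.subst, PreTerm.subst, hs.subst_even 1] at h₂
  have h₃ := hX.all_mem h₂ hu
  simp [PreFormula.subst, PreTerm.subst, hs.subst_even 2, ht.subst_even 2] at h₃
  have h₄ := hX.all_mem h₃ hv
  simp [PreFormula.subst, PreTerm.subst, hs.subst_even 3, ht.subst_even 3, hu.subst_even 3] at h₄
  have h₅ := hX.imp_mem (φ := .and (.eq s u) (.eq t v))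
    (ψ := .biimp (.le s t) (.le u v)) h₄ (hX.and_mem_iff.2 ⟨h, h'⟩)
  exact hX.imp_mem (hX.and_mem h₅).1 hle

/-- Provable equality of terms. -/
def setoid : Setoid Term where
  r s t := .eq s.1 t.1 ∈ X
  iseqv := ⟨fun s => hX.eq_refl hE s.2, fun {s t} => hX.eq_symm hE s.2 t.2,
    fun {s t u} => hX.eq_trans hE s.2 t.2 u.2⟩

/-- The quotient of the terms by provable equality. -/
abbrev TermModel : Type := Quotient (hX.setoid hE)

/-- The order is defined through representatives and so needs no proof of well-definedness;
congruence of `≤` enters only for negated literals in `sat_of_mem`. -/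
instance : ArithStructure (hX.TermModel hE) where
  zero := Quotient.mk _ ⟨.zero, isTerm_zero⟩
  succ := Quotient.map (fun s => ⟨s.1.succ, isTerm_succ.2 s.2⟩)
    fun s t h => hX.eq_succ hE s.2 t.2 h
  add := Quotient.map₂ (fun s t => ⟨s.1.add t.1, isTerm_add.2 ⟨s.2, t.2⟩⟩)
    fun s u h t v h' => hX.eq_add hE s.2 t.2 u.2 v.2 h h'
  mul := Quotient.map₂ (fun s t => ⟨s.1.mul t.1, isTerm_mul.2 ⟨s.2, t.2⟩⟩)
    fun s u h t v h' => hX.eq_mul hE s.2 t.2 u.2 v.2 h h'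
  le a b := ∃ s t : Term, Quotient.mk _ s = a ∧ Quotient.mk _ t = b ∧ .le s.1 t.1 ∈ X

/-- The assignment of the term model that maps each variable of odd index to itself. -/
def assignment (i : ℕ) : hX.TermModel hE :=
  if h : Odd i then Quotient.mk _ ⟨.var i, isTerm_var h⟩ else zero

theorem eval_assignment {t : PreTerm} (ht : t.IsTerm) :
    t.eval (hX.assignment hE) = Quotient.mk _ ⟨t, ht⟩ := by
  induction t with
  | var i =>
    have : Odd i := ht i (by simp [PreTerm.FV])
    simp [PreTerm.eval, assignment, this]
  | zero => rfl
  | succ t ih =>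
    simp only [PreTerm.eval, ih (isTerm_succ.1 ht)]; rfl
  | add s t ihs iht =>
    simp only [PreTerm.eval, ihs (isTerm_add.1 ht).1, iht (isTerm_add.1 ht).2]; rfl
  | mul s t ihs iht =>
    simp only [PreTerm.eval, ihs (isTerm_mul.1 ht).1, iht (isTerm_mul.1 ht).2]; rfl

/-- The truth lemma. In negation normal form one direction suffices, as negated atoms are cases of
their own. The induction is on complexity because the quantifier cases pass to substitution
instances. -/
theorem sat_of_mem {φ : PreFormula} (h : φ ∈ X) : φ.Sat (hX.assignment hE) := by
  have hf := hX.isFormula _ h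
  induction hn : φ.complexity using Nat.strong_induction_on generalizing φ with
  | _ n ih =>
  subst hn
  have lit {s t : PreTerm} (hst : ∀ i ∈ s.FV ∪ t.FV, Odd i) : s.IsTerm ∧ t.IsTerm :=
    ⟨fun i hi => hst i (Finset.mem_union_left _ hi),
      fun i hi => hst i (Finset.mem_union_right _ hi)⟩
  cases φ with
  | eq s t =>
    obtain ⟨hs, ht⟩ := lit hf
    simp only [PreFormula.Sat, eval_assignment, hs, ht]
    exact Quotient.sound h
  | neq s t =>
    obtain ⟨hs, ht⟩ := lit hf
    simp only [PreFormula.Sat, eval_assignment, hs, ht]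
    exact fun h' => hX.not_mem_neg h (Quotient.exact h')
  | le s t =>
    obtain ⟨hs, ht⟩ := lit hf
    simp only [PreFormula.Sat, eval_assignment, hs, ht]
    exact ⟨_, _, rfl, rfl, h⟩
  | nle s t =>
    obtain ⟨hs, ht⟩ := lit hf
    simp only [PreFormula.Sat, eval_assignment, hs, ht]
    rintro ⟨u, v, hu, hv, h'⟩
    exact hX.not_mem_neg h (hX.le_congr hE u.2 v.2 hs ht (Quotient.exact hu)
      (Quotient.exact hv) h')
  | and φ ψ =>
    obtain ⟨h₁, h₂⟩ := hX.and_mem h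
    exact ⟨ih _ (by simp [PreFormula.complexity]) h₁ (hX.isFormula _ h₁) rfl,
      ih _ (by simp [PreFormula.complexity]) h₂ (hX.isFormula _ h₂) rfl⟩
  | or φ ψ =>
    exact (hX.or_mem h).imp
      (fun h' => ih _ (by simp [PreFormula.complexity]) h' (hX.isFormula _ h') rfl)
      (fun h' => ih _ (by simp [PreFormula.complexity]) h' (hX.isFormula _ h') rfl)
  | all i φ =>
    intro a
    obtain ⟨⟨t, ht⟩, rfl⟩ := Quotient.exists_rep a
    have h' := hX.all_mem h ht
    have := ih _ (by simp [PreFormula.complexity, PreFormula.complexity_subst]) h'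
      (hX.isFormula _ h') rfl
    rwa [PreFormula.sat_subst_of_isTerm ht, hX.eval_assignment hE ht] at this
  | ex i φ =>
    obtain ⟨t, ht, h'⟩ := hX.witness _ _ h
    have := ih _ (by simp [PreFormula.complexity, PreFormula.complexity_subst]) h'
      (hX.isFormula _ h') rfl
    rw [PreFormula.sat_subst_of_isTerm ht] at this
    exact ⟨_, this⟩

end HenkinSet

/-- Completeness: a sentence is a theorem of `T` if it holds in all structures in which all
theorems of `T` hold. -/
theorem proves_of_forall_sat {T : Set PreFormula} (hT : IsTheory T) (hE : eqAxioms ⊆ T)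
    {φ : PreFormula} (hφ : φ.IsSentence)
    (h : ∀ (M : Type) [ArithStructure M] (σ : ℕ → M),
      (∀ θ : PreFormula, Proves T θ → θ.Sat σ) → φ.Sat σ) : Proves T φ := by
  by_contra hn
  have hTf : ∀ θ ∈ T, θ.IsFormula := fun θ hθ => (hT θ hθ).isFormula
  have hφn := PreFormula.isFormula_neg.2 hφ.isFormula
  have hirr : Irrefutable (insert φ.neg T) := by
    by_contra hirr
    obtain ⟨Δ, hΔ, hd⟩ := exists_derivable_of_not_irrefutable hTf hφn hirr
    exact hn ⟨Δ, hΔ, by rwa [PreFormula.neg_neg] at hd⟩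
  have hext : Extendable (insert φ.neg T) := by
    refine Extendable.insert ⟨hTf, hirr.mono (Set.subset_insert _ _), 0, fun θ hθ i hi => ?_⟩
      hφn hirr
    rw [hT θ hθ] at hi
    simp at hi
  obtain ⟨X, hsub, hX⟩ := hext.exists_henkinSet
  obtain ⟨hφX, hTX⟩ := Set.insert_subset_iff.1 hsub
  have hEX := hE.trans hTX
  refine (PreFormula.sat_neg φ (hX.assignment hEX)).1 (hX.sat_of_mem hEX hφX) (h _ _ ?_)
  -- Theorems, not only axioms, lie in `X`, since `X` is closed under derivability.
  rintro θ ⟨Δ, hΔ, hd⟩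
  exact hX.sat_of_mem hEX (hX.mem_of_derivable (fun δ hδ => hTX (hΔ δ hδ)) hd)

/-! ### Models of Robinson arithmetic -/

/-- The axioms of Robinson arithmetic, as properties of a structure. -/
structure RobinsonModel (M : Type) [ArithStructure M] : Prop where
  succ_inj : ∀ x y : M, succ x = succ y → x = y
  ne_zero_iff : ∀ x : M, x ≠ zero ↔ ∃ y, x = succ y
  le_iff : ∀ x y : M, le x y ↔ ∃ z, add z x = y
  add_zero : ∀ x : M, add x zero = x
  add_succ : ∀ x y : M, add x (succ y) = succ (add x y)
  mul_zero : ∀ x : M, mul x zero = zero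
  mul_succ : ∀ x y : M, mul x (succ y) = add (mul x y) x

theorem robinsonModel_of_sat {M : Type} [ArithStructure M] {σ : ℕ → M}
    (h : ∀ θ ∈ robinsonQ, θ.Sat σ) : RobinsonModel M := by
  simp only [robinsonQ, Set.mem_union, Set.mem_insert_iff, Set.mem_singleton_iff] at h
  simp only [or_imp, forall_and, forall_eq, PreFormula.Sat, PreFormula.sat_imp,
    PreFormula.sat_biimp, PreTerm.eval] at h
  obtain ⟨-, h₁, h₂, h₃, h₄, h₅, h₆, h₇⟩ := h
  exact ⟨by simpa using h₁, by simpa using h₂, by simpa using h₃, by simpa using h₄,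
    by simpa using h₅, by simpa using h₆, by simpa using h₇⟩

/-- The standard model. -/
instance : ArithStructure ℕ where
  zero := 0
  succ := Nat.succ
  add := (· + ·)
  mul := (· * ·)
  le := (· ≤ ·)

/-- The elements of a structure that are denoted by numerals. -/
def num (M : Type) [ArithStructure M] : ℕ → M
  | 0 => zero
  | n + 1 => succ (num M n)

theorem eval_numeral {M : Type} [ArithStructure M] (σ : ℕ → M) (n : ℕ) :
    (numeral n).eval σ = num M n := by
  induction n <;> simp_all [numeral, PreTerm.eval, num]

theorem num_nat (n : ℕ) : num ℕ n = n := by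
  induction n with
  | zero => rfl
  | succ n ih => exact congrArg Nat.succ ih

namespace RobinsonModel

variable (hM : RobinsonModel M)
include hM

theorem succ_ne_zero (x : M) : succ x ≠ zero := (hM.ne_zero_iff _).2 ⟨x, rfl⟩

theorem eq_zero_or_succ (x : M) : x = zero ∨ ∃ y, x = succ y := by
  by_cases h : x = zero
  · exact .inl h
  · exact .inr ((hM.ne_zero_iff x).1 h)

theorem num_inj {m n : ℕ} : num M m = num M n ↔ m = n := by
  refine ⟨fun h => ?_, fun h => h ▸ rfl⟩
  induction m generalizing n with
  | zero =>
    cases n with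
    | zero => rfl
    | succ n => exact (hM.succ_ne_zero _ h.symm).elim
  | succ m ih =>
    cases n with
    | zero => exact (hM.succ_ne_zero _ h).elim
    | succ n => exact congrArg _ (ih (hM.succ_inj _ _ h))

theorem add_num (m n : ℕ) : add (num M m) (num M n) = num M (m + n) := by
  induction n with
  | zero => exact hM.add_zero _
  | succ n ih => exact (hM.add_succ _ _).trans (congrArg succ ih)

theorem mul_num (m n : ℕ) : mul (num M m) (num M n) = num M (m * n) := by
  induction n with
  | zero => exact hM.mul_zero _
  | succ n ih =>
    refine (hM.mul_succ _ _).trans ?_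
    rw [ih, hM.add_num, Nat.mul_succ]

theorem eval_num (t : PreTerm) (σ : ℕ → ℕ) :
    t.eval (fun i => num M (σ i)) = num M (t.eval σ) := by
  induction t with
  | var i => rfl
  | zero => rfl
  | succ t ih => simp only [PreTerm.eval, ih]; rfl
  | add s t ihs iht => simp only [PreTerm.eval, ihs, iht, hM.add_num]; rfl
  | mul s t ihs iht => simp only [PreTerm.eval, ihs, iht, hM.mul_num]; rfl

/-- The numerals form an initial segment: from z + Sy = S(n) one gets z + y = n, so successors are
peeled off both sides until `x` or the bound is zero. -/
theorem le_num_iff (n : ℕ) (x : M) : le x (num M n) ↔ ∃ m ≤ n, x = num M m := by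
  constructor
  · intro h
    induction n generalizing x with
    | zero =>
      obtain ⟨z, hz⟩ := (hM.le_iff _ _).1 h
      rcases hM.eq_zero_or_succ x with rfl | ⟨y, rfl⟩
      · exact ⟨0, le_rfl, rfl⟩
      · rw [hM.add_succ] at hz
        exact (hM.succ_ne_zero _ hz).elim
    | succ n ih =>
      obtain ⟨z, hz⟩ := (hM.le_iff _ _).1 h
      rcases hM.eq_zero_or_succ x with rfl | ⟨y, rfl⟩
      · exact ⟨0, Nat.zero_le _, rfl⟩
      · rw [hM.add_succ] at hz
        obtain ⟨m, hm, rfl⟩ := ih y ((hM.le_iff _ _).2 ⟨z, hM.succ_inj _ _ hz⟩)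
        exact ⟨m + 1, Nat.succ_le_succ hm, rfl⟩
  · rintro ⟨m, hm, rfl⟩
    exact (hM.le_iff _ _).2 ⟨num M (n - m), by rw [hM.add_num, Nat.sub_add_cancel hm]⟩

theorem num_le_num {m n : ℕ} : le (num M m) (num M n) ↔ m ≤ n := by
  rw [hM.le_num_iff]
  exact ⟨fun ⟨k, hk, h⟩ => hM.num_inj.1 h ▸ hk, fun h => ⟨m, h, rfl⟩⟩

/-- Models of Q need not be linearly ordered, but numerals are comparable with every element, again
by peeling off successors. -/
theorem le_or_ge_num (n : ℕ) (x : M) : le x (num M n) ∨ le (num M n) x := by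
  induction n generalizing x with
  | zero => exact .inr ((hM.le_iff _ _).2 ⟨x, hM.add_zero x⟩)
  | succ n ih =>
    rcases hM.eq_zero_or_succ x with rfl | ⟨y, rfl⟩
    · exact .inl ((hM.le_num_iff _ _).2 ⟨0, Nat.zero_le _, rfl⟩)
    · refine (ih y).imp (fun h => ?_) fun h => ?_
      · obtain ⟨m, hm, rfl⟩ := (hM.le_num_iff _ _).1 h
        exact (hM.le_num_iff _ _).2 ⟨m + 1, Nat.succ_le_succ hm, rfl⟩
      · obtain ⟨z, hz⟩ := (hM.le_iff _ _).1 h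
        exact (hM.le_iff _ _).2 ⟨z, (hM.add_succ _ _).trans (congrArg succ hz)⟩

theorem num_le_of_le {m n : ℕ} (h : m ≤ n) {x : M} (hx : le (num M n) x) : le (num M m) x := by
  obtain ⟨z, rfl⟩ := (hM.le_iff _ _).1 hx
  obtain ⟨k, rfl⟩ := Nat.exists_eq_add_of_le' h
  -- Associativity of addition may fail in `M`; it holds when the last summand is a numeral, by
  -- induction on that numeral.
  refine (hM.le_iff _ _).2 ⟨add z (num M k), ?_⟩
  clear h hx
  induction m with
  | zero => exact hM.add_zero _
  | succ m ih =>
    exact (hM.add_succ _ _).trans ((congrArg succ ih).trans (hM.add_succ _ _).symm)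

end RobinsonModel

/-! ### Bounded formulas -/

/-- `∃ v_{2i} ≤ v_{2j}, φ`. -/
def PreFormula.bex (i j : ℕ) (φ : PreFormula) : PreFormula :=
  .ex i (.and (.le (.var (2 * i)) (.var (2 * j))) φ)

/-- `∀ v_{2i} ≤ v_{2j}, φ`. -/
def PreFormula.ball (i j : ℕ) (φ : PreFormula) : PreFormula :=
  .all i (.or (.nle (.var (2 * i)) (.var (2 * j))) φ)

/-- Formulas in which all quantifiers are bounded by variables. -/
inductive PreFormula.IsBounded : PreFormula → Prop
  | eq (s t : PreTerm) : IsBounded (.eq s t)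
  | le (s t : PreTerm) : IsBounded (.le s t)
  | and {φ ψ : PreFormula} : IsBounded φ → IsBounded ψ → IsBounded (.and φ ψ)
  | or {φ ψ : PreFormula} : IsBounded φ → IsBounded ψ → IsBounded (.or φ ψ)
  | bex {i j : ℕ} {φ : PreFormula} : i ≠ j → IsBounded φ → IsBounded (bex i j φ)
  | ball {i j : ℕ} {φ : PreFormula} : i ≠ j → IsBounded φ → IsBounded (ball i j φ)

theorem PreFormula.sat_bex {i j : ℕ} (hij : i ≠ j) (φ : PreFormula) (σ : ℕ → M) :
    (bex i j φ).Sat σ ↔ ∃ a, ArithStructure.le a (σ (2 * j)) ∧ φ.Sat (update σ (2 * i) a) := by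
  simp [bex, Sat, PreTerm.eval, Ne.symm hij]

theorem PreFormula.sat_ball {i j : ℕ} (hij : i ≠ j) (φ : PreFormula) (σ : ℕ → M) :
    (ball i j φ).Sat σ ↔ ∀ a, ArithStructure.le a (σ (2 * j)) → φ.Sat (update σ (2 * i) a) := by
  simp [ball, Sat, PreTerm.eval, Ne.symm hij, imp_iff_not_or]

/-- Bounded formulas have the same truth value for numerals in all models of Robinson
arithmetic. -/
theorem RobinsonModel.sat_num_iff (hM : RobinsonModel M) {φ : PreFormula} (hφ : φ.IsBounded)
    (σ : ℕ → ℕ) : φ.Sat (fun i => num M (σ i)) ↔ φ.Sat σ := by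
  have hupd (σ : ℕ → ℕ) (i a : ℕ) :
      update (fun i => num M (σ i)) i (num M a) = fun j => num M (update σ i a j) := by
    ext j; by_cases h : j = i <;> simp [update, h]
  induction hφ generalizing σ with
  | eq => simp [PreFormula.Sat, hM.eval_num, hM.num_inj]
  | le => simp only [PreFormula.Sat, hM.eval_num, hM.num_le_num]; rfl
  | and _ _ ih₁ ih₂ => simp only [PreFormula.Sat, ih₁, ih₂]
  | or _ _ ih₁ ih₂ => simp only [PreFormula.Sat, ih₁, ih₂]
  | bex hij _ ih =>
    rw [PreFormula.sat_bex hij, PreFormula.sat_bex hij]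
    constructor
    · rintro ⟨_, ha, h⟩
      obtain ⟨m, hm, rfl⟩ := (hM.le_num_iff _ _).1 ha
      rw [hupd] at h
      exact ⟨m, hm, (ih _).1 h⟩
    · rintro ⟨m, hm, h⟩
      refine ⟨num M m, hM.num_le_num.2 hm, ?_⟩
      rw [hupd]
      exact (ih _).2 h
  | ball hij _ ih =>
    rw [PreFormula.sat_ball hij, PreFormula.sat_ball hij]
    constructor
    · intro h m hm
      have := h _ (hM.num_le_num.2 hm)
      rw [hupd] at this
      exact (ih _).1 this
    · intro h _ ha
      obtain ⟨m, hm, rfl⟩ := (hM.le_num_iff _ _).1 ha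
      rw [hupd]
      exact (ih _).2 (h m hm)

/-! ### A bounded formula for the diagonal function -/

/-- Doubling removes the division by 2, so that pairing is expressed by an equation between terms.
-/
theorem cantorPair_succ_eq_iff (s t u : ℕ) :
    u = cantorPair s t + 1 ↔ u + u = t + t + ((s + t) * (s + t + 1) + 2) := by
  have := Nat.even_mul_succ_self (s + t)
  unfold cantorPair
  grind

/-- Gödel's β-function lemma, a consequence of the Chinese remainder theorem, taken from
`Nat.beta_unbeta_coe`. -/
theorem exists_mod_eq (g : ℕ → ℕ) (n : ℕ) :
    ∃ a d, ∀ i ≤ n, a % ((i + 1) * d + 1) = g i := by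
  let l := (List.range (n + 1)).map g
  refine ⟨(Nat.unbeta l).unpair.1, (Nat.unbeta l).unpair.2, fun i hi => ?_⟩
  have := Nat.beta_unbeta_coe l ⟨i, by simp [l]; omega⟩
  simpa [Nat.beta, l] using this

/-- `u` is the code of the sequence that extends the sequence with code `s` by `t`. -/
def snocFormula (s t u : PreTerm) : PreFormula :=
  .eq (.add u u) (.add (.add t t)
    (.add (.mul (.add s t) (.succ (.add s t))) (.succ (.succ .zero))))

/-- `r` is the remainder of `v_6` modulo `(i + 1) * v_8 + 1`, for `v_6 ≤ v_4`. -/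
def betaFormula (i r : PreTerm) : PreFormula :=
  .and (.le r (.mul (.succ i) (.var 8)))
    (.bex 11 2 (.eq (.var 6)
      (.add (.mul (.var 22) (.succ (.mul (.succ i) (.var 8)))) r)))

/-- `v_2` is the Gödel number of `∃ v_0 (v_0 = n ∧ φ)`, where `n` is both the value of `v_0` and
the Gödel number of `φ`, and `v_4` bounds all witnesses. -/
@[irreducible] def diagFormula : PreFormula :=
  .bex 3 2 (.bex 4 2 (.bex 5 2 (
    -- The pair (`v_6`, `v_8`) codes the Gödel numbers of the numerals 0, …, `v_0`: the entry at 0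
    -- is the code of the term 0, and each next entry arises by the code of S.
    .and (betaFormula .zero (numeral (seqCode [0, 1])))
    (.and (.ball 8 0 (.or (.eq (.var 16) (.var 0)) (.bex 9 2 (.bex 10 2
      (.and (betaFormula (.var 16) (.var 18))
      (.and (betaFormula (.succ (.var 16)) (.var 20))
        (snocFormula (numeral (seqCode [0, 2])) (.var 18) (.var 20))))))))
    (.and (betaFormula (.var 0) (.var 10))
    (.bex 6 2 (.bex 7 2 (.bex 12 2 (
      .and (snocFormula (numeral (seqCode [1, 0, seqCode [0, 0, 0]])) (.var 10) (.var 12))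
      (.and (snocFormula (numeral (seqCode [1, 4])) (.var 12) (.var 14))
      (.and (snocFormula (.var 14) (.var 0) (.var 24))
        (snocFormula (numeral (seqCode [1, 7, 0])) (.var 24) (.var 2)))))))))))))

theorem isBounded_betaFormula (i r : PreTerm) : (betaFormula i r).IsBounded :=
  .and (.le _ _) (.bex (by decide) (.eq _ _))

theorem isBounded_diagFormula : diagFormula.IsBounded := by
  rw [diagFormula]
  repeat' first
    | exact isBounded_betaFormula _ _
    | exact .eq _ _
    | refine .bex (by decide) ?_
    | refine .ball (by decide) ?_
    | refine .and ?_ ?_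
    | refine .or ?_ ?_

theorem eq_of_mem_FV_diagFormula {i : ℕ} : i ∈ diagFormula.FV → i = 0 ∨ i = 2 ∨ i = 4 := by
  simp [diagFormula, betaFormula, snocFormula, PreFormula.bex, PreFormula.ball, PreFormula.FV,
    PreTerm.FV, FV_numeral]
  omega

theorem sat_snocFormula (s t u : PreTerm) (σ : ℕ → ℕ) :
    (snocFormula s t u).Sat σ ↔ u.eval σ = cantorPair (s.eval σ) (t.eval σ) + 1 :=
  (cantorPair_succ_eq_iff _ _ _).symm

theorem sat_betaFormula {i r : PreTerm} (hi : 22 ∉ i.FV) (hr : 22 ∉ r.FV) {σ : ℕ → ℕ}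
    (hσ : σ 6 ≤ σ 4) :
    (betaFormula i r).Sat σ ↔ σ 6 % ((i.eval σ + 1) * σ 8 + 1) = r.eval σ := by
  have hev {t : PreTerm} (ht : 22 ∉ t.FV) (a : ℕ) : t.eval (update σ 22 a) = t.eval σ :=
    PreTerm.eval_congr fun j hj => by rw [update_of_ne]; rintro rfl; exact ht hj
  have : (betaFormula i r).Sat σ ↔ r.eval σ ≤ (i.eval σ + 1) * σ 8 ∧
      ∃ q ≤ σ 4, σ 6 = q * ((i.eval σ + 1) * σ 8 + 1) + r.eval σ := by
    simp only [betaFormula, PreFormula.Sat, PreFormula.sat_bex (show 11 ≠ 2 by decide),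
      PreTerm.eval, Nat.reduceMul, hev hi, hev hr, update_self]
    rfl
  rw [this]
  constructor
  · rintro ⟨hle, q, -, hq⟩
    rw [hq, Nat.mul_add_mod_of_lt (Nat.lt_succ_of_le hle)]
  · intro h
    -- The quotient is at most `σ 6`, which is why `σ 6 ≤ σ 4` makes the bound `v_4` harmless.
    refine ⟨?_, σ 6 / ((i.eval σ + 1) * σ 8 + 1), (Nat.div_le_self _ _).trans hσ, ?_⟩
    · rw [← h]
      exact Nat.le_of_lt_succ (Nat.mod_lt _ (Nat.succ_pos _))
    · rw [← h, mul_comm, Nat.div_add_mod]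

/-- The diagonal function. -/
def diag (n : ℕ) : ℕ :=
  cantorPair (seqCode [1, 7, 0]) (cantorPair (cantorPair (seqCode [1, 4])
    (cantorPair (seqCode [1, 0, seqCode [0, 0, 0]]) (numeral n).gn + 1) + 1) n + 1) + 1

/-- Using ∃v_0 (v_0 = n ∧ φ) in place of φ(n) avoids arithmetising substitution: the code arises
from `n` and the code of its numeral by finitely many pairings. -/
theorem gn_ex_eq_numeral_and (n : ℕ) (φ : PreFormula) (hn : φ.gn = n) :
    (PreFormula.ex 0 (.and (.eq (.var 0) (numeral n)) φ)).gn = diag n := by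
  subst hn; rfl

theorem sat_diagFormula (σ : ℕ → ℕ) : diagFormula.Sat σ ↔
    ∃ a ≤ σ 4, ∃ d ≤ σ 4, ∃ g ≤ σ 4, a % (d + 1) = seqCode [0, 1] ∧
      (∀ i ≤ σ 0, i = σ 0 ∨ ∃ r ≤ σ 4, ∃ r' ≤ σ 4, a % ((i + 1) * d + 1) = r ∧
        a % ((i + 1 + 1) * d + 1) = r' ∧ r' = cantorPair (seqCode [0, 2]) r + 1) ∧
      a % ((σ 0 + 1) * d + 1) = g ∧
      ∃ p ≤ σ 4, ∃ q ≤ σ 4, ∃ r ≤ σ 4,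
        p = cantorPair (seqCode [1, 0, seqCode [0, 0, 0]]) g + 1 ∧
        q = cantorPair (seqCode [1, 4]) p + 1 ∧ r = cantorPair q (σ 0) + 1 ∧
        σ 2 = cantorPair (seqCode [1, 7, 0]) r + 1 := by
  have hle (a b : ℕ) : ArithStructure.le a b ↔ a ≤ b := Iff.rfl
  have hz : (zero : ℕ) = 0 := rfl
  have hs (a : ℕ) : succ a = a + 1 := rfl
  -- The first quantifier is treated separately to make `a ≤ σ 4` available for `sat_betaFormula`.
  rw [diagFormula, PreFormula.sat_bex (by decide)]
  refine exists_congr fun a => and_congr_right fun ha => ?_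
  replace ha : a ≤ σ 4 := ha
  simp [PreFormula.Sat, PreFormula.sat_bex, PreFormula.sat_ball, sat_snocFormula,
    sat_betaFormula, hle, hz, hs, ha, PreTerm.FV, FV_numeral, PreTerm.eval, eval_numeral, num_nat]

theorem diag_eq_of_sat {σ : ℕ → ℕ} (h : diagFormula.Sat σ) : σ 2 = diag (σ 0) := by
  obtain ⟨a, -, d, -, g, -, h₀, hs, hg, p, -, q, -, r, -, hp, hq, hr, hz⟩ :=
    (sat_diagFormula σ).1 h
  have key (i : ℕ) (hi : i ≤ σ 0) : a % ((i + 1) * d + 1) = (numeral i).gn := by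
    induction i with
    | zero => simpa [show (numeral 0).gn = seqCode [0, 1] from rfl] using h₀
    | succ i ih =>
      obtain ⟨r, -, r', -, hr, hr', h⟩ := (hs i (by omega)).resolve_left (by omega)
      rw [hr', h, ← hr, ih (by omega)]
      rfl
  rw [hz, hr, hq, hp, ← hg, key _ le_rfl]
  rfl

theorem exists_sat_diagFormula (n : ℕ) : ∃ b, diag n ≤ b ∧
    ∀ σ : ℕ → ℕ, σ 0 = n → σ 2 = diag n → σ 4 = b → diagFormula.Sat σ := by
  obtain ⟨a, d, hmod⟩ := exists_mod_eq (fun i => (numeral i).gn) n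
  let p := cantorPair (seqCode [1, 0, seqCode [0, 0, 0]]) (numeral n).gn + 1
  let q := cantorPair (seqCode [1, 4]) p + 1
  let r := cantorPair q n + 1
  -- The sum dominates all witnesses; the sequence entries are remainders of `a`, hence at most `a`.
  refine ⟨a + d + p + q + r + diag n, by omega, ?_⟩
  rintro σ rfl hz hb
  refine (sat_diagFormula σ).2 ⟨a, by omega, d, by omega, _, ?_, ?_, ?_, rfl,
    p, by omega, q, by omega, r, by omega, ?_, rfl, rfl, hz⟩
  · exact (Nat.mod_le _ _).trans (by omega)
  · simpa [show (numeral 0).gn = seqCode [0, 1] from rfl] using hmod 0 (Nat.zero_le _)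
  · intro i hi
    refine or_iff_not_imp_left.2 fun hne => ⟨_, (Nat.mod_le _ _).trans (by omega), _,
      (Nat.mod_le _ _).trans (by omega), rfl, rfl, ?_⟩
    rw [hmod i hi, hmod (i + 1) (by omega)]
    rfl
  · rw [hmod _ le_rfl]

/-! ### Representing the diagonal function, and the diagonal lemma -/

/-- `v_26` is the value of the diagonal function at `v_0`; uniqueness is built in with a bound
for the witnesses. -/
def diagGraph : PreFormula :=
  .ex 14 (.and (.bex 1 14 (.and (.eq (.var 2) (.var 26)) (.bex 2 14 diagFormula)))
    (.ball 1 14 (.ball 2 14 (.or diagFormula.neg (.eq (.var 2) (.var 26))))))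

theorem FV_diagGraph : diagGraph.FV ⊆ {0, 26} := by
  intro i
  have := @eq_of_mem_FV_diagFormula i
  simp [diagGraph, PreFormula.bex, PreFormula.ball, PreFormula.FV, PreTerm.FV,
    PreFormula.FV_neg] at this ⊢
  grind

theorem RobinsonModel.sat_diagFormula_num (hM : RobinsonModel M) {σ : ℕ → M} {n k m : ℕ}
    (h₀ : σ 0 = num M n) (h₂ : σ 2 = num M k) (h₄ : σ 4 = num M m) :
    diagFormula.Sat σ ↔ diagFormula.Sat (update (update (fun _ => n) 2 k) 4 m) := by
  rw [← hM.sat_num_iff isBounded_diagFormula]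
  refine PreFormula.sat_congr (φ := diagFormula) fun i hi => ?_
  have := eq_of_mem_FV_diagFormula hi
  rcases this with rfl | rfl | rfl <;> simp [h₀, h₂, h₄]

/-- Let `b` bound a true computation and let `c` be the bound in `diagGraph`. If `c ≤ b`, all
witnesses are numerals and absoluteness gives the true value. If `b ≤ c`, the true computation lies
below `c`, and the uniqueness clause forces `v_26` to equal its value. -/
theorem RobinsonModel.sat_diagGraph (hM : RobinsonModel M) {σ : ℕ → M} {n : ℕ}
    (h₀ : σ 0 = num M n) : diagGraph.Sat σ ↔ σ 26 = num M (diag n) := by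
  obtain ⟨b, hb, hsat⟩ := exists_sat_diagFormula n
  let E (c u w : M) : Prop :=
    diagFormula.Sat (update (update (update σ 28 c) 2 u) 4 w)
  have hD : diagGraph.Sat σ ↔ ∃ c, (∃ u, le u c ∧ u = σ 26 ∧ ∃ w, le w c ∧ E c u w) ∧
      ∀ u, le u c → ∀ w, le w c → ¬ E c u w ∨ u = σ 26 := by
    simp [diagGraph, PreFormula.Sat, PreFormula.sat_bex, PreFormula.sat_ball,
      PreFormula.sat_neg, PreTerm.eval, E]
  have hE (c : M) (k m : ℕ) : E c (num M k) (num M m) ↔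
      diagFormula.Sat (update (update (fun _ => n) 2 k) 4 m) :=
    hM.sat_diagFormula_num (by simpa using h₀) (by simp) (by simp)
  have htrue (c : M) : E c (num M (diag n)) (num M b) :=
    (hE _ _ _).2 (hsat _ (by simp) (by simp) (by simp))
  have huniq {c : M} {k m : ℕ} (h : E c (num M k) (num M m)) : k = diag n := by
    simpa using diag_eq_of_sat ((hE _ _ _).1 h)
  rw [hD]
  constructor
  · rintro ⟨c, ⟨u, hu, hz, w, hw, h⟩, hall⟩
    rcases hM.le_or_ge_num b c with hc | hc
    · obtain ⟨c, -, rfl⟩ := (hM.le_num_iff _ _).1 hc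
      obtain ⟨k, -, rfl⟩ := (hM.le_num_iff _ _).1 hu
      obtain ⟨m, -, rfl⟩ := (hM.le_num_iff _ _).1 hw
      rw [← hz, huniq h]
    · exact ((hall _ (hM.num_le_of_le hb hc) _ hc).resolve_left (not_not.2 (htrue c))).symm
  · intro hz
    refine ⟨num M b, ⟨_, hM.num_le_num.2 hb, hz.symm, _, hM.num_le_num.2 le_rfl, htrue _⟩, ?_⟩
    intro u hu w hw
    obtain ⟨k, -, rfl⟩ := (hM.le_num_iff _ _).1 hu
    obtain ⟨m, -, rfl⟩ := (hM.le_num_iff _ _).1 hw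
    refine or_iff_not_imp_left.2 fun h => ?_
    rw [hz, huniq (not_not.1 h)]

/-- The diagonal lemma, in semantic form. -/
theorem exists_fixedPoint {θ : PreFormula} {y : ℕ} (hθ : θ.FV ⊆ {y}) :
    ∃ ψ : PreFormula, ψ.IsSentence ∧ ∀ (M : Type) [ArithStructure M], RobinsonModel M →
      ∀ σ : ℕ → M, ψ.Sat σ ↔ (θ.atCode y ψ).Sat σ := by
  -- `v_{2k}` is not bound in θ and differs from `v_26`. Substituting `v_26` directly could lead to
  -- capture, so its value is passed on to `v_{2k}` by an equation.
  let k := θ.BV.sup id + 14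
  have hkθ : ∀ j ∈ θ.BV, j ∉ (PreTerm.var (2 * k)).FV := fun j hj hjk => by
    have : j ≤ θ.BV.sup id := Finset.le_sup (f := id) hj
    simp only [PreTerm.FV, Finset.mem_singleton] at hjk
    omega
  let χ : PreFormula := .all 13 (.or diagGraph.neg
    (.all k (.or (.neq (.var (2 * k)) (.var 26)) (θ.subst y (.var (2 * k))))))
  refine ⟨.ex 0 (.and (.eq (.var 0) (numeral χ.gn)) χ), ?_, fun M _ hM σ => ?_⟩
  · refine Finset.eq_empty_of_forall_notMem fun i hi => ?_
    have h₁ := @FV_diagGraph i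
    have h₂ := θ.FV_subst_subset y (.var (2 * k))
    have h₃ := @hθ i
    replace h₂ := @h₂ i
    simp only [χ, PreFormula.FV, PreTerm.FV, FV_numeral, PreFormula.FV_neg] at hi h₁ h₂ h₃
    simp at hi h₁ h₂ h₃
    grind
  · have hx (σ : ℕ → M) (h₀ : σ 0 = num M χ.gn) :
        χ.Sat σ ↔ θ.Sat (update σ y (num M (diag χ.gn))) := by
      have hk : (26 : ℕ) ≠ 2 * k := by omega
      have hg (z : M) : diagGraph.Sat (update σ (2 * 13) z) ↔ z = num M (diag χ.gn) := by
        rw [hM.sat_diagGraph (n := χ.gn) (by simpa using h₀)]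
        simp
      have hs (z : M) : θ.Sat (update (update (update σ (2 * 13) z) (2 * k) z) y z) ↔
          θ.Sat (update σ y z) := PreFormula.sat_congr fun i hi => by
        have := hθ hi
        simp only [Finset.mem_singleton] at this
        simp [this]
      simp only [χ, PreFormula.Sat, PreFormula.sat_neg, hg, PreFormula.sat_subst hkθ,
        PreTerm.eval, update_self, ne_eq, ← imp_iff_not_or, forall_eq]
      simp only [update_of_ne hk, Nat.reduceMul, update_self, forall_eq]
      exact hs _
    rw [PreFormula.atCode, gn_ex_eq_numeral_and _ _ rfl,
      PreFormula.sat_subst_of_isTerm (isTerm_numeral _), eval_numeral]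
    simp only [PreFormula.Sat, PreTerm.eval, eval_numeral, Nat.mul_zero, update_self,
      exists_eq_left]
    rw [hx _ (by simp)]
    refine PreFormula.sat_congr fun i hi => ?_
    have := hθ hi
    simp only [Finset.mem_singleton] at this
    simp [this]

/-! ### Löb's theorem -/

namespace PreFormula

theorem IsSentence.imp {φ ψ : PreFormula} (hφ : φ.IsSentence) (hψ : ψ.IsSentence) :
    (φ.imp ψ).IsSentence := by
  simp_all [IsSentence, PreFormula.imp, FV, FV_neg]

theorem isSentence_atCode {θ : PreFormula} {y : ℕ} (hθ : θ.FV ⊆ {y}) (φ : PreFormula) :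
    (θ.atCode y φ).IsSentence := by
  refine Finset.eq_empty_of_forall_notMem fun i hi => ?_
  have h₁ := θ.FV_subst_subset y (numeral φ.gn) hi
  have h₂ := @hθ i
  simp [FV_numeral] at h₁ h₂
  tauto

end PreFormula

/-- With this, derivations in `T` from known theorems reduce to truth-value arguments in models of
Q. -/
theorem proves_of_robinsonModel {T : Set PreFormula} (hT : IsTheory T) (hQ : robinsonQ ⊆ T)
    {φ : PreFormula} (hφ : φ.IsSentence)
    (h : ∀ (M : Type) [ArithStructure M] (σ : ℕ → M), RobinsonModel M →
      (∀ θ : PreFormula, Proves T θ → θ.Sat σ) → φ.Sat σ) : Proves T φ := by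
  have hax : ∀ θ ∈ T, Proves T θ := fun θ hθ =>
    ⟨{θ}, by simpa using hθ, by simpa using derivable_em (hT θ hθ).isFormula⟩
  refine proves_of_forall_sat hT (Set.subset_union_left.trans hQ) hφ fun M _ σ hσ => ?_
  exact h M σ (robinsonModel_of_sat fun θ hθ => hσ θ (hax θ (hQ hθ))) hσ

theorem loeb {T : Set PreFormula} (hT : IsTheory T) (hQ : robinsonQ ⊆ T) {Pr : PreFormula}
    {y : ℕ} (hPr : Pr.FV ⊆ {y}) (hHB : HilbertBernays T Pr y) {φ : PreFormula}
    (hφ : φ.IsSentence) (h : Proves T ((Pr.atCode y φ).imp φ)) : Proves T φ := by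
  have hθ : (Pr.imp φ).FV ⊆ {y} := by
    have : φ.FV = ∅ := hφ
    simpa [PreFormula.imp, PreFormula.FV, PreFormula.FV_neg, this] using hPr
  obtain ⟨ψ, hψ, hfix⟩ := exists_fixedPoint hθ
  have hcode (χ : PreFormula) : (Pr.atCode y χ).IsSentence := PreFormula.isSentence_atCode hPr χ
  have hat : (Pr.imp φ).atCode y ψ = (Pr.atCode y ψ).imp φ := by
    have : y ∉ φ.FV := by simp [show φ.FV = ∅ from hφ]
    simp only [PreFormula.atCode, PreFormula.imp, PreFormula.subst, PreFormula.neg_subst,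
      PreFormula.subst_eq_self _ this]
  simp only [hat, PreFormula.sat_imp] at hfix
  have hψ' : Proves T (ψ.imp ((Pr.atCode y ψ).imp φ)) :=
    proves_of_robinsonModel hT hQ (hψ.imp ((hcode ψ).imp hφ)) fun M _ σ hM _ => by
      simp only [PreFormula.sat_imp]
      exact (hfix M hM σ).1
  have d1 := hHB.d1 _ (hψ.imp ((hcode ψ).imp hφ)) hψ'
  have d2 := hHB.d2 ψ hψ
  have d3 := hHB.d3 ψ _ hψ ((hcode ψ).imp hφ)
  have d3' := hHB.d3 _ φ (hcode ψ) hφ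
  -- In a structure satisfying the theorems of `T`, truth of Pr(⌜ψ⌝) yields Pr(⌜φ⌝) and then φ,
  -- which is what the fixed point ψ asserts.
  have hP : Proves T ψ := proves_of_robinsonModel hT hQ hψ fun M _ σ hM hσ => by
    have e1 := hσ _ d1
    have e2 := hσ _ d2
    have e3 := hσ _ d3
    have e4 := hσ _ d3'
    have e5 := hσ _ h
    simp only [PreFormula.sat_imp, PreFormula.Sat] at e2 e3 e4 e5
    rw [hfix M hM]
    tauto
  have d1' := hHB.d1 ψ hψ hP
  refine proves_of_robinsonModel hT hQ hφ fun M _ σ hM hσ => ?_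
  exact (hfix M hM σ).1 (hσ _ hP) (hσ _ d1')

end FOArith
/-- Löb's theorem and Gödel's second incompleteness theorem. Here `Pr` is a formula of
first-order arithmetic with no free variable other than `v_y`. -/
theorem mainTheorem9 (T : Set FOArith.PreFormula) (hT : FOArith.IsTheory T)
    (hQ : FOArith.robinsonQ ⊆ T)
    (Pr : FOArith.PreFormula) (y : ℕ) (hPr : Pr.IsFormula) (hy : Pr.FV ⊆ {y})
    (hHB : FOArith.HilbertBernays T Pr y) :
    (∀ φ : FOArith.PreFormula, φ.IsSentence →
      FOArith.Proves T ((Pr.atCode y φ).imp φ) → FOArith.Proves T φ) ∧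
    (FOArith.Consistent T →
      ¬ FOArith.Proves T
        (Pr.atCode y (.eq .zero (.succ .zero))).neg) := by
  have hloeb : ∀ φ : FOArith.PreFormula, φ.IsSentence →
      FOArith.Proves T ((Pr.atCode y φ).imp φ) → FOArith.Proves T φ :=
    fun _ hφ h => FOArith.loeb hT hQ hy hHB hφ h
  refine ⟨hloeb, fun hcons hn => hcons ?_⟩
  have hs : (FOArith.PreFormula.eq .zero (.succ .zero)).IsSentence := by
    simp [FOArith.PreFormula.IsSentence, FOArith.PreFormula.FV, FOArith.PreTerm.FV]
  -- Since `T` refutes Pr(⌜0 = S0⌝), it proves Pr(⌜0 = S0⌝) → 0 = S0 vacuously, and Löb's theorem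
  -- gives 0 = S0, which fails in every model of Q.
  have h01 := hloeb _ hs <| FOArith.proves_of_robinsonModel hT hQ
    ((FOArith.PreFormula.isSentence_atCode hy _).imp hs) fun M _ σ _ hσ =>
      (FOArith.PreFormula.sat_imp _ _ _).2
        fun h => ((FOArith.PreFormula.sat_neg _ _).1 (hσ _ hn) h).elim
  refine FOArith.proves_of_robinsonModel hT hQ ?_ fun M _ σ hM hσ =>
    (hM.succ_ne_zero _ (hσ _ h01).symm).elim
  simp [FOArith.PreFormula.bot, FOArith.PreFormula.IsSentence, FOArith.PreFormula.FV,
    FOArith.PreTerm.FV]
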